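/- Let $E=\mathbb{R}^n$ with an arbitrary norm $N$, let $d_N(x,y)=N(x-y)$ and $p\ge 1$. Let $\mathcal{W}_p(E)$ be the set of Borel probability measures $\mu$ on $E$ with $\int d_N(x,x_0)^p\,d\mu(x)<\infty$ for some $x_0\in E$, with the distance $$d_{\mathcal{W}_p}(\mu,\nu)=\inf_{\pi\in\Pi(\mu,\nu)}\Big(\iint d_N(x,y)^p\,d\pi(x,y)\Big)^{1/p},$$ where $\Pi(\mu,\nu)$ is the set of couplings of $\mu$ and $\nu$. An isometry of $\mathcal{W}_p(E)$ is a distance-preserving bijection of $\mathcal{W}_p(E)$ onto itself. The norm projects uniquely onto a linear subspace $L\subset E$ if every $x\in E$ has exactly one nearest point $P_L(x)$ in $L$. A measure is supported on $A$ if its support is contained in $A$. Let $L\subset E$ be a linear subspace onto which $N$ projects uniquely. Say that a linear subspace $H\subset E$ restricts images (with respect to $L$ and $p$) if $H\subset P_L^{-1}(0)$ and, for every isometry $\Phi$ of $\mathcal{W}_p(E)$ that fixes all measures supported on translates of $L$, one has $\operatorname{supp}\Phi(\mu)\subset\overline{H+\operatorname{supp}\mu}$ for all $\mu\in\mathcal{W}_p(E)$.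 Then: 1. There exists a linear subspace $H$ that restricts images. 2. Let $H$ be any linear subspace that restricts images, and let $\Phi$ be an isometry of $\mathcal{W}_p(E)$ with $\Phi(\mu)=\mu$ for every $\mu$ supported on a translate of $L$. If $N$ projects uniquely onto $H$ and $\Phi(\nu)=\nu$ for every $\nu\in\mathcal{W}_p(E)$ supported on $H$, then $\Phi(\mu)=\mu$ for all $\mu\in\mathcal{W}_p(E)$. -/

import Mathlib

open MeasureTheory
open scoped ENNReal Pointwise

/-! ### Unique projections in a normed space -/

section Projection

variable {E : Type*} [NormedAddCommGroup E] [NormedSpace ℝ E]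

/-- `y` is a nearest point to `x` in the linear subspace `L`. -/
def IsNearestPoint (L : Submodule ℝ E) (x y : E) : Prop :=
  y ∈ L ∧ ∀ z ∈ L, dist x y ≤ dist x z

/-- The norm of `E` projects uniquely onto the linear subspace `L`: every point of `E` has exactly
one nearest point in `L`. -/
def ProjectsUniquely (L : Submodule ℝ E) : Prop :=
  ∀ x : E, ∃! y : E, IsNearestPoint L x y

/-- The projection map `P_L : E → E`, sending `x` to its unique nearest point in `L`. -/
noncomputable def nearestProj {L : Submodule ℝ E} (hL : ProjectsUniquely L) (x : E) : E :=
  (hL x).choose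

theorem nearestProj_spec {L : Submodule ℝ E} (hL : ProjectsUniquely L) (x : E) :
    IsNearestPoint L x (nearestProj hL x) :=
  (hL x).choose_spec.1

end Projection

/-! ### The Wasserstein space -/

section Wasserstein

/-- The `p`-Wasserstein space over `E`: the Borel probability measures on `E` with finite
`p`-th moment. -/
def WassersteinSpace (p : ℝ) (E : Type*) [NormedAddCommGroup E] [MeasurableSpace E] : Type _ :=
  {μ : ProbabilityMeasure E // ∃ x₀ : E, ∫⁻ x, edist x x₀ ^ p ∂(μ : Measure E) < ∞}

variable {p : ℝ} {E : Type*} [NormedAddCommGroup E] [MeasurableSpace E]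

/-- The measure underlying a point of the Wasserstein space. -/
def WassersteinSpace.toMeasure (μ : WassersteinSpace p E) : Measure E :=
  ((μ.1 : ProbabilityMeasure E) : Measure E)

/-- `π` is a coupling of `μ` and `ν`: its marginals are `μ` and `ν`. -/
def IsCoupling (π : Measure (E × E)) (μ ν : Measure E) : Prop :=
  π.map Prod.fst = μ ∧ π.map Prod.snd = ν

/-- The `p`-Wasserstein distance. On the Wasserstein space it is finite for `p ≥ 1`; its values are
recorded as extended nonnegative reals. -/
noncomputable def wassersteinDist (μ ν : WassersteinSpace p E) : ℝ≥0∞ :=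
  ⨅ (π : Measure (E × E)) (_ : IsCoupling π μ.toMeasure ν.toMeasure),
    (∫⁻ z, edist z.1 z.2 ^ p ∂π) ^ (1 / p)

/-- A bijection of the Wasserstein space onto itself is an isometry if it preserves the Wasserstein
distance. -/
def IsWassersteinIsometry (Φ : WassersteinSpace p E ≃ WassersteinSpace p E) : Prop :=
  ∀ μ ν : WassersteinSpace p E, wassersteinDist (Φ μ) (Φ ν) = wassersteinDist μ ν

/-- The (topological) support of a point of the Wasserstein space. -/
def WassersteinSpace.supp (μ : WassersteinSpace p E) : Set E :=
  μ.toMeasure.support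

/-- `Φ` fixes every measure whose support is contained in `A`. -/
def FixesMeasuresOn (Φ : WassersteinSpace p E ≃ WassersteinSpace p E) (A : Set E) : Prop :=
  ∀ μ : WassersteinSpace p E, μ.supp ⊆ A → Φ μ = μ

variable [NormedSpace ℝ E]

/-- `Φ` fixes every measure supported on a translate `v + L` of the linear subspace `L`. -/
def FixesMeasuresOnTranslates (Φ : WassersteinSpace p E ≃ WassersteinSpace p E)
    (L : Submodule ℝ E) : Prop :=
  ∀ v : E, FixesMeasuresOn Φ (v +ᵥ (L : Set E))

/-- `H` is a linear subspace contained in `P_L⁻¹(0)` that controls the spreading of supports: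
for every isometry `Φ` of the `p`-Wasserstein space that fixes all measures supported on translates
of `L`, and for every `μ`, the support of `Φ μ` is contained in the closure of `H + supp μ`.
(The closure matters only when `H + supp μ` is not closed; it may be dropped when `supp μ` is
compact, in particular when it is finite.) -/
def RestrictsImages (p : ℝ) [BorelSpace E] {L : Submodule ℝ E} (hL : ProjectsUniquely L)
    (H : Submodule ℝ E) : Prop :=
  (H : Set E) ⊆ nearestProj hL ⁻¹' {0} ∧
    ∀ Φ : WassersteinSpace p E ≃ WassersteinSpace p E,
      IsWassersteinIsometry Φ → FixesMeasuresOnTranslates Φ L →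
        ∀ μ : WassersteinSpace p E, (Φ μ).supp ⊆ closure ((H : Set E) + μ.supp)

end Wasserstein

/-! If `Φ` fixes every measure on a finite set `t`, then minimising `transportCost p μ β + ∫ ψ dβ`
over `β` on `t` shows that `∫ min_z (d(x,z)^p + ψ z) dμ` is the same for `μ` and `Φ μ`.
Differentiating in one value of `ψ` turns integrals of minima into measures of sets. This gives
`map_powDiff_apply_eq`: the joint law of the functions `x ↦ ‖x - v - l‖^p - ‖x - v‖^p` is invariant
as soon as `Φ` fixes the measures on the finite set of base points `v`, `v + l`.

Existence of `H`. For `L ≠ ⊥` take `invariantSubmodule p L`, the translations that leave all these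
functions with `l ∈ L` unchanged. Its elements satisfy `‖h - l‖^p = ‖h‖^p + ‖l‖^p`, so they project
to `0`. For a finitely supported `μ`, blowing up at points of differentiability of the norm shows
that `Φ μ` lives on finitely many cosets of `H`. If the atoms are in general position, comparing
laws for base points near an atom shows that its mass stays in its own coset
(`measure_singleton_le_measure_sub_mem`). Density of such measures gives the support inclusion in
general. For `L = ⊥` take `H = ⊤`.

Rigidity. The functions with `l ∈ H` separate the points of each coset of `H`
(`eq_zero_of_powDiff_add_eq`), so fixing the measures on `H` fixes the finitely supported measures
on all its translates. A two-point measure on `{x₁, x₂}` could only move if `x₂ - x₁ = U + k` with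
`k ∈ H` and `U` invariant. Then `x₁, x₁ + k, x₁ + U, x₂` form a grid with additive costs, on which
`Φ` preserves row and column sums. A one-parameter family of measures remains; `Φ` acts on it
isometrically, and a comparison with nearby marginals excludes the reflection
(`IsCostGrid.apply_eq_of_le`). Once all two-point measures are fixed, the gradients of the
differences pin down finitely supported measures in general position, and these are dense. -/

open Filter Topology

/-! ### Transport costs and Wasserstein isometries -/

section TransportCost

variable {E : Type*} [NormedAddCommGroup E] [MeasurableSpace E] {p : ℝ}

/-- The optimal transport cost for the cost function `edist x y ^ p`. -/
noncomputable def transportCost (p : ℝ) (μ ν : Measure E) : ℝ≥0∞ :=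
  ⨅ (π : Measure (E × E)) (_ : IsCoupling π μ ν), ∫⁻ z, edist z.1 z.2 ^ p ∂π

instance WassersteinSpace.isProbabilityMeasure_toMeasure (μ : WassersteinSpace p E) :
    IsProbabilityMeasure μ.toMeasure := μ.1.2

theorem WassersteinSpace.ext_toMeasure {μ ν : WassersteinSpace p E}
    (h : μ.toMeasure = ν.toMeasure) : μ = ν :=
  Subtype.ext (Subtype.ext h)

theorem wassersteinDist_eq_transportCost (hp : 0 < p) (μ ν : WassersteinSpace p E) :
    wassersteinDist μ ν = transportCost p μ.toMeasure ν.toMeasure ^ (1 / p) := by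
  change _ = ENNReal.orderIsoRpow (1 / p) (one_div_pos.2 hp) (transportCost p _ _)
  simp only [transportCost, OrderIso.map_iInf, ENNReal.orderIsoRpow_apply]
  rfl

theorem transportCost_le_of_coupling {π : Measure (E × E)} {μ ν : Measure E}
    (h : IsCoupling π μ ν) : transportCost p μ ν ≤ ∫⁻ z, edist z.1 z.2 ^ p ∂π :=
  iInf₂_le π h

theorem IsWassersteinIsometry.transportCost_eq (hp : 0 < p)
    {Φ : WassersteinSpace p E ≃ WassersteinSpace p E} (hΦ : IsWassersteinIsometry Φ)
    (μ ν : WassersteinSpace p E) :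
    transportCost p (Φ μ).toMeasure (Φ ν).toMeasure
      = transportCost p μ.toMeasure ν.toMeasure := by
  have h := hΦ μ ν
  rw [wassersteinDist_eq_transportCost hp, wassersteinDist_eq_transportCost hp] at h
  exact (ENNReal.orderIsoRpow (1 / p) (one_div_pos.2 hp)).injective h

theorem IsWassersteinIsometry.symm {Φ : WassersteinSpace p E ≃ WassersteinSpace p E}
    (hΦ : IsWassersteinIsometry Φ) : IsWassersteinIsometry Φ.symm := fun μ ν => by
  simpa using (hΦ (Φ.symm μ) (Φ.symm ν)).symm

/-- `Φ` fixes every measure concentrated on a finite subset of `Z`. -/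
def FixesFinite (Φ : WassersteinSpace p E ≃ WassersteinSpace p E) (Z : Set E) : Prop :=
  ∀ (β : WassersteinSpace p E) (t : Finset E), (t : Set E) ⊆ Z →
    β.toMeasure (t : Set E)ᶜ = 0 → Φ β = β

theorem FixesFinite.mono {Φ : WassersteinSpace p E ≃ WassersteinSpace p E} {Z Z' : Set E}
    (h : FixesFinite Φ Z) (hZ : Z' ⊆ Z) : FixesFinite Φ Z' :=
  fun β t ht hβ => h β t (ht.trans hZ) hβ

theorem FixesFinite.symm {Φ : WassersteinSpace p E ≃ WassersteinSpace p E} {Z : Set E}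
    (h : FixesFinite Φ Z) : FixesFinite Φ.symm Z := fun β t ht hβ => by
  rw [Equiv.symm_apply_eq]; exact (h β t ht hβ).symm

theorem lintegral_edist_rpow_lt_top_of_finset (hp : 0 < p) (β : Measure E)
    [IsProbabilityMeasure β] (t : Finset E) (h : β (t : Set E)ᶜ = 0) (x : E) :
    ∫⁻ y, edist y x ^ p ∂β < ∞ := by
  have hb : ∀ᵐ y ∂β, edist y x ^ p ≤ t.sup fun z => edist z x ^ p := by
    have : (t : Set E) ∈ ae β := h
    filter_upwards [this] with y hy
    exact Finset.le_sup (f := fun z => edist z x ^ p) hy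
  refine (lintegral_mono_ae hb).trans_lt ?_
  rw [lintegral_const, measure_univ, mul_one, Finset.sup_lt_iff (by simp)]
  intro z _
  exact ENNReal.rpow_lt_top_of_nonneg hp.le (edist_ne_top _ _)

/-- A probability measure concentrated on a finite set, as a point of the Wasserstein space. -/
def WassersteinSpace.ofFinite (hp : 0 < p) (β : Measure E) [hβ : IsProbabilityMeasure β]
    (t : Finset E) (h : β (t : Set E)ᶜ = 0) : WassersteinSpace p E :=
  ⟨⟨β, hβ⟩, 0, lintegral_edist_rpow_lt_top_of_finset hp β t h 0⟩

theorem WassersteinSpace.lintegral_edist_rpow_lt_top [BorelSpace E] [SecondCountableTopology E]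
    (hp : 1 ≤ p) (μ : WassersteinSpace p E)
    (x : E) : ∫⁻ y, edist y x ^ p ∂μ.toMeasure < ∞ := by
  obtain ⟨x₀, hx₀⟩ := μ.2
  have h : ∀ y, edist y x ^ p ≤ 2 ^ (p - 1) * (edist y x₀ ^ p + edist x₀ x ^ p) := fun y =>
    (ENNReal.rpow_le_rpow (edist_triangle y x₀ x) (by linarith)).trans
      (ENNReal.rpow_add_le_mul_rpow_add_rpow _ _ hp)
  refine (lintegral_mono h).trans_lt ?_
  rw [lintegral_const_mul _ (by fun_prop), lintegral_add_right _ measurable_const,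
    lintegral_const, measure_univ, mul_one]
  refine ENNReal.mul_lt_top (ENNReal.rpow_lt_top_of_nonneg (by linarith) (by simp)) ?_
  exact ENNReal.add_lt_top.2 ⟨hx₀, ENNReal.rpow_lt_top_of_nonneg (by linarith) (edist_ne_top _ _)⟩

/-- A measurable choice of minimiser is what makes the cheapest transport onto a finite set a
push-forward. -/
theorem Finset.exists_measurable_argmin {α β : Type*} [MeasurableSpace α] [MeasurableSpace β]
    (t : Finset β) (ht : t.Nonempty) (f : α → β → ℝ≥0∞)
    (hf : ∀ b, Measurable fun a => f a b) :
    ∃ s : α → β, Measurable s ∧ ∀ a, s a ∈ t ∧ f a (s a) = t.inf (f a) := by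
  classical
  induction ht using Finset.Nonempty.cons_induction with
  | singleton b => exact ⟨fun _ => b, measurable_const, fun a => by simp⟩
  | cons b t hb ht ih =>
    obtain ⟨s, hs, hs'⟩ := ih
    have hm : Measurable fun a => t.inf (f a) := by
      have : (fun a => t.inf (f a)) = t.inf fun b a => f a b := by
        ext a; rw [Finset.inf_apply]
      rw [this]
      exact Finset.inf_induction (p := Measurable) measurable_const
        (fun _ h1 _ h2 => h1.inf h2) fun b _ => hf b
    refine ⟨fun a => if f a b ≤ t.inf (f a) then b else s a,
      Measurable.ite (measurableSet_le (hf b) hm) measurable_const hs, fun a => ?_⟩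
    by_cases h : f a b ≤ t.inf (f a)
    · simp [h]
    · simp only [h, if_false]
      refine ⟨Finset.mem_cons_of_mem (hs' a).1, ?_⟩
      rw [Finset.inf_cons, (hs' a).2, inf_eq_right.2 (not_le.1 h).le]

end TransportCost

/-! ### Integrals of minima that fixed measures make invariant -/

section FixedMeasures

variable {E : Type*} [NormedAddCommGroup E] [MeasurableSpace E] [BorelSpace E]
  [SecondCountableTopology E] {p : ℝ}

/-- Sending each point to its minimiser produces a measure `β` on `t` that attains equality for `μ`.
Since `Φ β = β`, it is a competitor of the same cost for `Φ μ`. The inverse isometry gives the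
opposite inequality. -/
theorem lintegral_finsetInf_apply_le (hp : 0 < p)
    {Φ : WassersteinSpace p E ≃ WassersteinSpace p E} (hΦ : IsWassersteinIsometry Φ)
    (t : Finset E) (ht : t.Nonempty) (hfix : FixesFinite Φ (t : Set E)) {ψ : E → ℝ≥0∞}
    (hψ : Measurable ψ) (μ : WassersteinSpace p E) :
    ∫⁻ x, t.inf (fun z => edist x z ^ p + ψ z) ∂(Φ μ).toMeasure
      ≤ ∫⁻ x, t.inf (fun z => edist x z ^ p + ψ z) ∂μ.toMeasure := by
  obtain ⟨s, hs, hs'⟩ := t.exists_measurable_argmin ht (fun x z => edist x z ^ p + ψ z)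
    (fun z => by fun_prop)
  have hβ : (μ.toMeasure.map s) (t : Set E)ᶜ = 0 := by
    rw [Measure.map_apply hs t.measurableSet.compl]
    convert measure_empty (μ := μ.toMeasure)
    ext x
    simpa using (hs' x).1
  have : IsProbabilityMeasure (μ.toMeasure.map s) := Measure.isProbabilityMeasure_map hs.aemeasurable
  set β := WassersteinSpace.ofFinite hp (μ.toMeasure.map s) t hβ with hβdef
  have hΦβ : Φ β = β := hfix β t subset_rfl hβ
  have h1 : ∫⁻ x, t.inf (fun z => edist x z ^ p + ψ z) ∂(Φ μ).toMeasure
      ≤ transportCost p (Φ μ).toMeasure β.toMeasure + ∫⁻ z, ψ z ∂β.toMeasure := by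
    unfold transportCost
    simp only [ENNReal.iInf_add]
    refine le_iInf₂ fun π hπ => ?_
    have hae : ∀ᵐ w ∂π, w.2 ∈ (t : Set E) := by
      have : ∀ᵐ z ∂(π.map Prod.snd), z ∈ (t : Set E) := by rw [hπ.2]; exact hβ
      exact ae_of_ae_map measurable_snd.aemeasurable this
    calc ∫⁻ x, t.inf (fun z => edist x z ^ p + ψ z) ∂(Φ μ).toMeasure
        ≤ ∫⁻ w, t.inf (fun z => edist w.1 z ^ p + ψ z) ∂π := by
          rw [← hπ.1]; exact lintegral_map_le _ _
      _ ≤ ∫⁻ w, (edist w.1 w.2 ^ p + ψ w.2) ∂π := by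
          refine lintegral_mono_ae ?_
          filter_upwards [hae] with w hw
          exact Finset.inf_le (f := fun z => edist w.1 z ^ p + ψ z) hw
      _ = ∫⁻ w, edist w.1 w.2 ^ p ∂π + ∫⁻ z, ψ z ∂β.toMeasure := by
          rw [lintegral_add_left (by fun_prop), ← hπ.2, lintegral_map hψ measurable_snd]
  refine h1.trans ?_
  have h2 : transportCost p (Φ μ).toMeasure β.toMeasure
      = transportCost p μ.toMeasure β.toMeasure := by
    conv_lhs => rw [← hΦβ]
    exact hΦ.transportCost_eq hp μ β
  have hc : IsCoupling (μ.toMeasure.map fun x => (x, s x)) μ.toMeasure β.toMeasure := by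
    constructor
    · rw [Measure.map_map measurable_fst (by fun_prop)]
      exact Measure.map_id
    · rw [Measure.map_map measurable_snd (by fun_prop)]
      rfl
  have h3 := transportCost_le_of_coupling (p := p) hc
  rw [lintegral_map (by fun_prop) (by fun_prop)] at h3
  rw [h2]
  calc transportCost p μ.toMeasure β.toMeasure + ∫⁻ z, ψ z ∂β.toMeasure
      ≤ ∫⁻ x, edist x (s x) ^ p ∂μ.toMeasure + ∫⁻ z, ψ z ∂β.toMeasure := by gcongr
    _ = ∫⁻ x, (edist x (s x) ^ p + ψ (s x)) ∂μ.toMeasure := by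
        rw [lintegral_add_left (by fun_prop)]
        congr 1
        exact lintegral_map hψ hs
    _ ≤ _ := lintegral_mono fun x => (hs' x).2.le

theorem lintegral_finsetInf_apply_eq (hp : 0 < p)
    {Φ : WassersteinSpace p E ≃ WassersteinSpace p E} (hΦ : IsWassersteinIsometry Φ)
    (t : Finset E) (ht : t.Nonempty) (hfix : FixesFinite Φ (t : Set E)) {ψ : E → ℝ≥0∞}
    (hψ : Measurable ψ) (μ : WassersteinSpace p E) :
    ∫⁻ x, t.inf (fun z => edist x z ^ p + ψ z) ∂(Φ μ).toMeasure
      = ∫⁻ x, t.inf (fun z => edist x z ^ p + ψ z) ∂μ.toMeasure := by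
  refine le_antisymm (lintegral_finsetInf_apply_le hp hΦ t ht hfix hψ μ) ?_
  have := lintegral_finsetInf_apply_le hp hΦ.symm t ht hfix.symm hψ (Φ μ)
  simpa using this

theorem lintegral_iInf_apply_eq (hp : 0 < p)
    {Φ : WassersteinSpace p E ≃ WassersteinSpace p E} (hΦ : IsWassersteinIsometry Φ)
    {κ : Type*} [Finite κ] [Nonempty κ] (z : κ → E) (hfix : FixesFinite Φ (Set.range z))
    (ψ : κ → ℝ≥0∞) (μ : WassersteinSpace p E) :
    ∫⁻ x, ⨅ k, (edist x (z k) ^ p + ψ k) ∂(Φ μ).toMeasure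
      = ∫⁻ x, ⨅ k, (edist x (z k) ^ p + ψ k) ∂μ.toMeasure := by
  classical
  have := Fintype.ofFinite κ
  -- The family `z` may repeat points, so each point receives the least of its weights.
  set Ψ : E → ℝ≥0∞ := fun y => ⨅ k, if y = z k then ψ k else ⊤ with hΨ
  have hΨm : Measurable Ψ := Measurable.iInf fun k =>
    Measurable.ite (measurableSet_singleton (z k)) measurable_const measurable_const
  have key : ∀ x, (Finset.univ.image z).inf (fun y => edist x y ^ p + Ψ y)
      = ⨅ k, (edist x (z k) ^ p + ψ k) := by
    intro x
    rw [Finset.inf_image, Finset.inf_univ_eq_iInf]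
    refine le_antisymm (le_iInf fun k => (iInf_le _ k).trans ?_) (le_iInf fun k => ?_)
    · simp only [Function.comp, hΨ]
      gcongr
      exact (iInf_le _ k).trans (by simp)
    · simp only [Function.comp, hΨ, ENNReal.add_iInf]
      refine le_iInf fun j => ?_
      by_cases h : z k = z j
      · rw [if_pos h, h]; exact iInf_le _ j
      · simp [h]
  have := lintegral_finsetInf_apply_eq hp hΦ (Finset.univ.image z)
    (Finset.univ_nonempty.image z) (by simpa using hfix) hΨm μ
  simpa only [key] using this

end FixedMeasures

/-! ### Invariant joint laws of differences of distance powers -/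

section Law

theorem Measure.ext_of_pi_Ioi {ι : Type*} [Finite ι] {μ ν : Measure (ι → ℝ)}
    [IsProbabilityMeasure μ] [IsProbabilityMeasure ν]
    (h : ∀ a : ι → ℝ, μ (Set.univ.pi fun i => Set.Ioi (a i))
      = ν (Set.univ.pi fun i => Set.Ioi (a i))) : μ = ν := by
  have hgen : ∀ _ : ι, MeasurableSpace.generateFrom (Set.range (Set.Ioi : ℝ → Set ℝ))
      = (inferInstance : MeasurableSpace ℝ) := fun _ => by
    rw [← borel_eq_generateFrom_Ioi]; exact (BorelSpace.measurable_eq).symm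
  have hspan : ∀ _ : ι, IsCountablySpanning (Set.range (Set.Ioi : ℝ → Set ℝ)) := fun _ => by
    refine ⟨fun n : ℕ => Set.Ioi (-(n : ℝ)), fun n => ⟨_, rfl⟩, ?_⟩
    refine Set.eq_univ_of_forall fun x => Set.mem_iUnion.2 ?_
    obtain ⟨n, hn⟩ := exists_nat_gt (-x)
    exact ⟨n, by simp only [Set.mem_Ioi]; linarith⟩
  refine ext_of_generate_finite _ (generateFrom_eq_pi hgen hspan).symm
    (IsPiSystem.pi fun _ => isPiSystem_Ioi) ?_ (by simp)
  rintro _ ⟨s, hs, rfl⟩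
  choose a ha using fun i => hs i (Set.mem_univ i)
  obtain rfl : (fun i => Set.Ioi (a i)) = s := funext ha
  exact h a

variable {E : Type*} [NormedAddCommGroup E]

/-- The difference of two powers of the norm with base points `l` and `0`. -/
noncomputable def powDiff (p : ℝ) (l x : E) : ℝ := ‖x - l‖ ^ p - ‖x‖ ^ p

theorem continuous_powDiff {p : ℝ} (hp : 0 ≤ p) (l : E) : Continuous (powDiff p l) :=
  ((continuous_id.sub continuous_const).norm.rpow_const fun _ => Or.inr hp).sub
    (continuous_norm.rpow_const fun _ => Or.inr hp)

theorem edist_rpow_eq_ofReal {p : ℝ} (hp : 0 ≤ p) (x y : E) :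
    edist x y ^ p = ENNReal.ofReal (‖x - y‖ ^ p) := by
  rw [edist_dist, dist_eq_norm, ENNReal.ofReal_rpow_of_nonneg (norm_nonneg _) hp]

theorem ENNReal.tendsto_mul_min_add_inv_sub {a m : ℝ≥0∞} (ha : a ≠ ∞) :
    Tendsto (fun n : ℕ => (n : ℝ≥0∞) * (min (a + (n : ℝ≥0∞)⁻¹) m - min a m)) atTop
      (𝓝 (if a < m then 1 else 0)) := by
  split_ifs with h
  · have h1 : ∀ᶠ n : ℕ in atTop, a + (n : ℝ≥0∞)⁻¹ < m := by
      have : Tendsto (fun n : ℕ => a + (n : ℝ≥0∞)⁻¹) atTop (𝓝 (a + 0)) :=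
        tendsto_const_nhds.add ENNReal.tendsto_inv_nat_nhds_zero
      rw [add_zero] at this
      exact this.eventually_lt_const h
    refine tendsto_const_nhds.congr' ?_
    filter_upwards [h1, eventually_ge_atTop 1] with n hn hn1
    rw [min_eq_left hn.le, min_eq_left h.le, ENNReal.add_sub_cancel_left ha,
      ENNReal.mul_inv_cancel (by exact_mod_cast (by lia : n ≠ 0)) (by simp)]
  · refine tendsto_const_nhds.congr fun n => ?_
    have h' := not_lt.1 h
    rw [min_eq_right h', min_eq_right (h'.trans le_self_add), tsub_self, mul_zero]

variable [MeasurableSpace E] [BorelSpace E] [SecondCountableTopology E] {p : ℝ}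

/-- The right derivative of `c ↦ min (a + c) m` at `0` is the indicator of `a < m`. The difference
quotients with `c = 1/n` are bounded by `1`, so the derivative passes under the invariant integrals.
-/
theorem measure_lt_apply_eq (hp : 1 ≤ p)
    {Φ : WassersteinSpace p E ≃ WassersteinSpace p E} (hΦ : IsWassersteinIsometry Φ)
    {ι : Type*} [Finite ι] (v : E) (l : ι → E)
    (hfix : FixesFinite Φ (insert v (Set.range fun i => v + l i))) (ψ₀ : ℝ≥0∞) (hψ₀ : ψ₀ ≠ ∞)
    (ψ : ι → ℝ≥0∞) (μ : WassersteinSpace p E) :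
    (Φ μ).toMeasure {x | edist x v ^ p + ψ₀ < ⨅ i, (edist x (v + l i) ^ p + ψ i)}
      = μ.toMeasure {x | edist x v ^ p + ψ₀ < ⨅ i, (edist x (v + l i) ^ p + ψ i)} := by
  set m : E → ℝ≥0∞ := fun x => ⨅ i, (edist x (v + l i) ^ p + ψ i) with hm
  set a : E → ℝ≥0∞ := fun x => edist x v ^ p + ψ₀ with ha
  have hmm : Measurable m := Measurable.iInf fun i => by fun_prop
  have ham : Measurable a := by fun_prop
  have key : ∀ c : ℝ≥0∞, ∫⁻ x, min (a x + c) (m x) ∂(Φ μ).toMeasure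
      = ∫⁻ x, min (a x + c) (m x) ∂μ.toMeasure := by
    intro c
    have h := lintegral_iInf_apply_eq (by linarith) hΦ
      (fun o : Option ι => o.elim v fun i => v + l i)
      (hfix.mono (by rintro _ ⟨o, rfl⟩; cases o <;> simp)) (fun o => o.elim (ψ₀ + c) ψ) μ
    simp only [iInf_option, Option.elim, ← add_assoc] at h
    exact h
  have ha_fin : ∀ x, a x ≠ ∞ := fun x =>
    ENNReal.add_ne_top.2 ⟨ENNReal.rpow_ne_top_of_nonneg (by linarith) (edist_ne_top _ _), hψ₀⟩
  have hlim : ∀ ρ : WassersteinSpace p E, Tendsto (fun n : ℕ => (n : ℝ≥0∞) *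
      (∫⁻ x, min (a x + (n : ℝ≥0∞)⁻¹) (m x) ∂ρ.toMeasure - ∫⁻ x, min (a x + 0) (m x) ∂ρ.toMeasure))
      atTop (𝓝 (ρ.toMeasure {x | a x < m x})) := by
    intro ρ
    have hfin : ∫⁻ x, min (a x + 0) (m x) ∂ρ.toMeasure ≠ ∞ := by
      refine ((lintegral_mono fun x => min_le_left _ _).trans_lt ?_).ne
      simp only [ha, add_zero]
      rw [lintegral_add_right _ measurable_const, lintegral_const, measure_univ, mul_one]
      exact ENNReal.add_lt_top.2 ⟨ρ.lintegral_edist_rpow_lt_top hp v, hψ₀.lt_top⟩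
    have hset : MeasurableSet {x | a x < m x} := measurableSet_lt ham hmm
    have hr : ρ.toMeasure {x | a x < m x} = ∫⁻ x, (if a x < m x then 1 else 0) ∂ρ.toMeasure := by
      rw [← lintegral_indicator_one hset]
      refine lintegral_congr fun x => ?_
      simp [Set.indicator_apply]
    rw [hr]
    have heq : ∀ n : ℕ, (n : ℝ≥0∞) * (∫⁻ x, min (a x + (n : ℝ≥0∞)⁻¹) (m x) ∂ρ.toMeasure
        - ∫⁻ x, min (a x + 0) (m x) ∂ρ.toMeasure)
        = ∫⁻ x, (n : ℝ≥0∞) * (min (a x + (n : ℝ≥0∞)⁻¹) (m x) - min (a x) (m x))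
          ∂ρ.toMeasure := by
      intro n
      rw [lintegral_const_mul _ (by fun_prop)]
      simp only [add_zero] at hfin ⊢
      rw [lintegral_sub (by fun_prop) hfin]
      exact Eventually.of_forall fun x => min_le_min_right _ le_self_add
    simp only [heq]
    refine tendsto_lintegral_of_dominated_convergence (fun _ => 1) (fun n => by fun_prop)
      (fun n => Eventually.of_forall fun x => ?_) (by simp)
      (Eventually.of_forall fun x => ENNReal.tendsto_mul_min_add_inv_sub (ha_fin x))
    have : min (a x + (n : ℝ≥0∞)⁻¹) (m x) ≤ min (a x) (m x) + (n : ℝ≥0∞)⁻¹ := by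
      rw [← min_add_add_right]
      exact min_le_min_left _ le_self_add
    calc (n : ℝ≥0∞) * (min (a x + (n : ℝ≥0∞)⁻¹) (m x) - min (a x) (m x))
        ≤ n * (n : ℝ≥0∞)⁻¹ := by
          gcongr
          exact tsub_le_iff_left.2 this
      _ ≤ 1 := ENNReal.mul_inv_le_one _
  have h1 := hlim (Φ μ)
  simp only [key] at h1
  exact tendsto_nhds_unique h1 (hlim μ)

/-- The joint law of finitely many differences of powers of distances is invariant. -/
theorem map_powDiff_apply_eq (hp : 1 ≤ p)
    {Φ : WassersteinSpace p E ≃ WassersteinSpace p E} (hΦ : IsWassersteinIsometry Φ)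
    {ι : Type*} [Finite ι] (v : E) (l : ι → E)
    (hfix : FixesFinite Φ (insert v (Set.range fun i => v + l i))) (μ : WassersteinSpace p E) :
    (Φ μ).toMeasure.map (fun x i => powDiff p (l i) (x - v))
      = μ.toMeasure.map (fun x i => powDiff p (l i) (x - v)) := by
  have hp0 : 0 ≤ p := by linarith
  have hX : Measurable (fun (x : E) i => powDiff p (l i) (x - v)) :=
    measurable_pi_lambda _ fun i =>
      ((continuous_powDiff hp0 (l i)).comp (continuous_id.sub continuous_const)).measurable
  have := Measure.isProbabilityMeasure_map (μ := (Φ μ).toMeasure) hX.aemeasurable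
  have := Measure.isProbabilityMeasure_map (μ := μ.toMeasure) hX.aemeasurable
  refine Measure.ext_of_pi_Ioi fun a => ?_
  have hms : MeasurableSet (Set.univ.pi fun i => Set.Ioi (a i)) :=
    MeasurableSet.univ_pi fun i => measurableSet_Ioi
  rw [Measure.map_apply hX hms, Measure.map_apply hX hms]
  have := Fintype.ofFinite ι
  -- The weights must be nonnegative; adding the same `K` to both sides makes every `K - a i`
  -- admissible.
  set K : ℝ := ∑ i, |a i| with hK
  have hK0 : 0 ≤ K := Finset.sum_nonneg fun i _ => abs_nonneg _
  have hKa : ∀ i, 0 ≤ K - a i := fun i => by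
    have := Finset.single_le_sum (f := fun i => |a i|) (fun i _ => abs_nonneg _)
      (Finset.mem_univ i)
    have := le_abs_self (a i)
    linarith
  have h := measure_lt_apply_eq hp hΦ v l hfix (ENNReal.ofReal K) ENNReal.ofReal_ne_top
    (fun i => ENNReal.ofReal (K - a i)) μ
  have hset : (fun x i => powDiff p (l i) (x - v)) ⁻¹' (Set.univ.pi fun i => Set.Ioi (a i))
      = {x | edist x v ^ p + ENNReal.ofReal K
          < ⨅ i, (edist x (v + l i) ^ p + ENNReal.ofReal (K - a i))} := by
    ext x
    simp only [Set.mem_preimage, Set.mem_pi, Set.mem_univ, true_implies, Set.mem_Ioi,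
      Set.mem_ofPred_eq, edist_rpow_eq_ofReal hp0, powDiff]
    have hnn : ∀ y : E, 0 ≤ ‖y‖ ^ p := fun y => Real.rpow_nonneg (norm_nonneg _) _
    simp only [← ENNReal.ofReal_add (hnn _) hK0, ← ENNReal.ofReal_add (hnn _) (hKa _)]
    rw [← Finset.inf_univ_eq_iInf, Finset.lt_inf_iff ENNReal.ofReal_lt_top]
    refine forall_congr' fun i => ?_
    simp only [Finset.mem_univ, true_implies]
    rw [ENNReal.ofReal_lt_ofReal_iff_of_nonneg (add_nonneg (hnn _) hK0),
      ← sub_sub]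
    constructor <;> intro h <;> linarith
  rw [hset]
  exact h

theorem measure_powDiff_eq_apply_eq (hp : 1 ≤ p)
    {Φ : WassersteinSpace p E ≃ WassersteinSpace p E} (hΦ : IsWassersteinIsometry Φ)
    {ι : Type*} [Finite ι] (v : E) (l : ι → E)
    (hfix : FixesFinite Φ (insert v (Set.range fun i => v + l i))) (μ : WassersteinSpace p E)
    {T : Set (ι → ℝ)} (hT : MeasurableSet T) :
    (Φ μ).toMeasure {x | (fun i => powDiff p (l i) (x - v)) ∈ T}
      = μ.toMeasure {x | (fun i => powDiff p (l i) (x - v)) ∈ T} := by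
  have hX : Measurable (fun (x : E) i => powDiff p (l i) (x - v)) :=
    measurable_pi_lambda _ fun i =>
      ((continuous_powDiff (by linarith) (l i)).comp
        (continuous_id.sub continuous_const)).measurable
  have h := map_powDiff_apply_eq hp hΦ v l hfix μ
  have h1 := congrArg (fun ρ => ρ T) h
  rwa [Measure.map_apply hX hT, Measure.map_apply hX hT] at h1

/-- A point of the support of the image of a finitely supported measure cannot be told apart from
all atoms of that measure. -/
theorem exists_powDiff_eq_of_mem_supp_apply (hp : 1 ≤ p)
    {Φ : WassersteinSpace p E ≃ WassersteinSpace p E} (hΦ : IsWassersteinIsometry Φ)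
    (v : E) (M : Set E) (hfix : FixesFinite Φ (insert v ((fun l => v + l) '' M)))
    {μ : WassersteinSpace p E} {S : Finset E} (hμ : μ.toMeasure (S : Set E)ᶜ = 0)
    {y : E} (hy : y ∈ (Φ μ).supp) :
    ∃ s ∈ S, ∀ l ∈ M, powDiff p l (y - v) = powDiff p l (s - v) := by
  by_contra! hcon
  choose! l hlM hl using hcon
  have hp0 : 0 ≤ p := by linarith
  -- If some `l s` separates `y` from each atom `s`, then avoiding all these values is an open
  -- condition that holds at `y` but at no atom. It is null for `μ`, hence for `Φ μ`.
  set T : Set (S → ℝ) := Set.univ.pi fun s => {powDiff p (l s) (s - v)}ᶜ with hT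
  have hTm : MeasurableSet T :=
    MeasurableSet.univ_pi fun s => (measurableSet_singleton _).compl
  have hTo : IsOpen T := isOpen_set_pi Set.finite_univ fun s _ => isOpen_compl_singleton
  have hcont : Continuous fun (x : E) (i : S) => powDiff p (l i) (x - v) :=
    continuous_pi fun i => (continuous_powDiff hp0 _).comp (continuous_id.sub continuous_const)
  have h := measure_powDiff_eq_apply_eq hp hΦ v (fun s : S => l s)
    (hfix.mono (Set.insert_subset_insert (by
      rintro _ ⟨s, rfl⟩; exact ⟨_, hlM s s.2, rfl⟩))) μ hTm
  have h0 : μ.toMeasure {x | (fun i : S => powDiff p (l i) (x - v)) ∈ T} = 0 := by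
    refine measure_mono_null ?_ hμ
    intro x hx hxS
    exact hx ⟨x, hxS⟩ (Set.mem_univ _) rfl
  rw [h0] at h
  refine ((Measure.mem_support_iff_forall _).1 hy _ ((hTo.preimage hcont).mem_nhds ?_)).ne' h
  intro s _
  exact hl s s.2

end Law

/-! ### Small transport cost and measures of thickenings -/

section Thickening

variable {E : Type*} [NormedAddCommGroup E] [MeasurableSpace E] [BorelSpace E]
  [SecondCountableTopology E] {p : ℝ}

theorem exists_coupling_measure_edist_le (hp : 0 < p) {α β : Measure E} {δ : ℝ} (hδ : 0 < δ)
    {η : ℝ≥0∞} (h : transportCost p α β < ENNReal.ofReal δ ^ p * η) :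
    ∃ π : Measure (E × E), IsCoupling π α β ∧ π {z | ENNReal.ofReal δ ≤ edist z.1 z.2} ≤ η := by
  have hδp : ENNReal.ofReal δ ^ p ≠ 0 := by simp [hδ]
  have hδt : ENNReal.ofReal δ ^ p ≠ ∞ := ENNReal.rpow_ne_top_of_nonneg hp.le ENNReal.ofReal_ne_top
  obtain ⟨π, hπ⟩ := iInf_lt_iff.1 h
  obtain ⟨hc, hπ⟩ := iInf_lt_iff.1 hπ
  refine ⟨π, hc, ?_⟩
  have hM := mul_meas_ge_le_lintegral (μ := π) (f := fun z : E × E => edist z.1 z.2 ^ p)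
    (by fun_prop) (ENNReal.ofReal δ ^ p)
  simp only [ENNReal.rpow_le_rpow_iff hp] at hM
  exact (ENNReal.mul_le_mul_iff_right hδp hδt).1 (hM.trans hπ.le)

/-- By Markov's inequality, some coupling moves mass at most `η` by `δ` or more. -/
theorem measure_le_thickening_add (hp : 0 < p) {α β : Measure E} {A : Set E}
    (hA : MeasurableSet A) {δ : ℝ} (hδ : 0 < δ) {η : ℝ≥0∞}
    (h : transportCost p α β < ENNReal.ofReal δ ^ p * η) :
    α A ≤ β (Metric.thickening δ A) + η := by
  obtain ⟨π, ⟨rfl, rfl⟩, hπ⟩ := exists_coupling_measure_edist_le hp hδ h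
  rw [Measure.map_apply measurable_fst hA,
    Measure.map_apply measurable_snd Metric.isOpen_thickening.measurableSet]
  refine (measure_mono ?_).trans ((measure_union_le _ _).trans (add_le_add_right hπ _))
  intro z hz
  by_cases hd : ENNReal.ofReal δ ≤ edist z.1 z.2
  · exact Or.inr hd
  · refine Or.inl (Metric.mem_thickening_iff.2 ⟨z.1, hz, ?_⟩)
    rw [not_le, edist_comm, edist_dist, ENNReal.ofReal_lt_ofReal_iff hδ] at hd
    exact hd

theorem measure_le_thickening_add' (hp : 0 < p) {α β : Measure E} {A : Set E}
    (hA : MeasurableSet A) {δ : ℝ} (hδ : 0 < δ) {η : ℝ≥0∞}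
    (h : transportCost p α β < ENNReal.ofReal δ ^ p * η) :
    β A ≤ α (Metric.thickening δ A) + η := by
  obtain ⟨π, ⟨rfl, rfl⟩, hπ⟩ := exists_coupling_measure_edist_le hp hδ h
  rw [Measure.map_apply measurable_snd hA,
    Measure.map_apply measurable_fst Metric.isOpen_thickening.measurableSet]
  refine (measure_mono ?_).trans ((measure_union_le _ _).trans (add_le_add_right hπ _))
  intro z hz
  by_cases hd : ENNReal.ofReal δ ≤ edist z.1 z.2
  · exact Or.inr hd
  · refine Or.inl (Metric.mem_thickening_iff.2 ⟨z.2, hz, ?_⟩)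
    rw [not_le, edist_dist, ENNReal.ofReal_lt_ofReal_iff hδ] at hd
    exact hd

/-- Two probability measures that can be approximated simultaneously are equal. -/
theorem measure_eq_of_transportCost_lt (hp : 0 < p) {α α' : Measure E} [IsProbabilityMeasure α]
    [IsProbabilityMeasure α']
    (h : ∀ η : ℝ≥0∞, η ≠ 0 → ∃ β : Measure E, transportCost p α β < η ∧ transportCost p α' β < η) :
    α = α' := by
  -- Passing through `β` with two half-thickenings replaces a triangle inequality for transport
  -- costs.
  have key : ∀ F : Set E, IsClosed F → ∀ δ : ℝ, 0 < δ → α F ≤ α' (Metric.cthickening δ F) := by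
    intro F hF δ hδ
    refine ENNReal.le_of_forall_pos_le_add fun η hη _ => ?_
    have hne : ENNReal.ofReal (δ / 2) ^ p * (η / 2 : ℝ≥0∞) ≠ 0 := by
      simp [hδ, hη.ne']
    obtain ⟨β, h1, h2⟩ := h _ hne
    have e1 := measure_le_thickening_add hp hF.measurableSet (half_pos hδ) h1
    have e2 := measure_le_thickening_add' hp
      (Metric.isOpen_thickening (δ := δ / 2) (E := F)).measurableSet (half_pos hδ) h2
    calc α F ≤ α' (Metric.thickening (δ / 2) (Metric.thickening (δ / 2) F)) + η / 2 + η / 2 :=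
          e1.trans (add_le_add_left e2 _)
      _ ≤ α' (Metric.cthickening δ F) + η := by
          rw [add_assoc, ENNReal.add_halves]
          gcongr
          refine (Metric.thickening_thickening_subset _ _ _).trans ?_
          rw [add_halves]
          exact Metric.thickening_subset_cthickening _ _
  have hle : ∀ F : Set E, IsClosed F → α F ≤ α' F := by
    intro F hF
    have hlim := tendsto_measure_cthickening_of_isClosed (μ := α')
      ⟨1, one_pos, measure_ne_top _ _⟩ hF
    refine ge_of_tendsto (hlim.mono_left (nhdsWithin_le_nhds (s := Set.Ioi 0))) ?_
    filter_upwards [self_mem_nhdsWithin] with δ hδ using key F hF δ hδ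
  refine (Measure.eq_of_le_of_isProbabilityMeasure (μ := α) (ν := α') ?_)
  refine Measure.le_intro fun s hs _ => ?_
  rw [hs.measure_eq_iSup_isClosed_of_ne_top (measure_ne_top _ _)]
  exact iSup₂_le fun K hK => iSup_le fun hKc => (hle K hKc).trans (measure_mono hK)

end Thickening

/-! ### Blow-up at points of differentiability -/

section LineDerivative

variable {E : Type*} [NormedAddCommGroup E] [NormedSpace ℝ E]

/-- If `ξ y` differed from every `ξ s`, the first-order terms would separate `w + ε • y` from all `w
+ ε • s` at once for small `ε`, as `S` is finite. -/
theorem exists_apply_eq_of_forall_exists_eq {f : E → ℝ} {ξ : E →L[ℝ] ℝ} {w y : E}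
    (hf : HasFDerivAt f ξ w) {S : Finset E}
    (h : ∀ ε : ℝ, 0 < ε → ∃ s ∈ S, f (w + ε • y) = f (w + ε • s)) : ∃ s ∈ S, ξ y = ξ s := by
  by_contra! hcon
  have hev : ∀ s ∈ S, ∀ᶠ ε in 𝓝[>] (0 : ℝ), f (w + ε • y) ≠ f (w + ε • s) := by
    intro s hs
    have hd : HasDerivAt (fun t : ℝ => f (w + t • y) - f (w + t • s)) (ξ y - ξ s) 0 :=
      HasDerivAt.sub (hf.hasLineDerivAt y) (hf.hasLineDerivAt s)
    have := hd.eventually_ne (c := 0) (sub_ne_zero.2 (hcon s hs))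
    filter_upwards [this.filter_mono (nhdsWithin_mono _ fun x hx => ne_of_gt hx)] with ε hε
    exact sub_ne_zero.1 hε
  obtain ⟨ε, hε, hε0⟩ := (((S.eventually_all).2 hev).and self_mem_nhdsWithin).exists
  obtain ⟨s, hs, hs'⟩ := h ε hε0
  exact hε s hs hs'

theorem eventually_ne_of_apply_ne {f : E → ℝ} {ξ : E →L[ℝ] ℝ} {w y z : E}
    (hf : HasFDerivAt f ξ w) (h : ξ y ≠ ξ z) :
    ∀ᶠ ε in 𝓝[>] (0 : ℝ), f (w + ε • y) ≠ f (w + ε • z) := by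
  have hd : HasDerivAt (fun t : ℝ => f (w + t • y) - f (w + t • z)) (ξ y - ξ z) 0 :=
    HasDerivAt.sub (hf.hasLineDerivAt y) (hf.hasLineDerivAt z)
  have := hd.eventually_ne (c := 0) (sub_ne_zero.2 h)
  filter_upwards [this.filter_mono (nhdsWithin_mono _ fun x hx => ne_of_gt hx)] with ε hε
  exact sub_ne_zero.1 hε

/-- A basis of the span of `Λ` is finite and each of its members takes finitely many values on `A`.
One representative for each value vector suffices, because vanishing on the basis means vanishing on
`Λ`. -/
theorem exists_finset_forall_exists_apply_sub_eq_zero [FiniteDimensional ℝ E]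
    (Λ : Set (E →L[ℝ] ℝ)) (A : Set E) (S : Finset E)
    (h : ∀ ξ ∈ Λ, ∀ y ∈ A, ∃ s ∈ S, ξ y = ξ s) :
    ∃ Y : Finset E, (Y : Set E) ⊆ A ∧ ∀ a ∈ A, ∃ y ∈ Y, ∀ ξ ∈ Λ, ξ (a - y) = 0 := by
  classical
  obtain ⟨b, hbΛ, hspan, hli⟩ := exists_linearIndependent ℝ Λ
  have hbfin : Finite b := hli.finite
  let φ : E → b → ℝ := fun y ξ => ξ.1 y
  have hfin : (φ '' A).Finite := by
    refine (Set.Finite.pi' (t := fun ξ : b => ξ.1 '' (S : Set E))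
      fun ξ => S.finite_toSet.image _).subset ?_
    rintro _ ⟨y, hy, rfl⟩ ξ
    obtain ⟨s, hs, hs'⟩ := h ξ (hbΛ ξ.2) y hy
    exact ⟨s, hs, hs'.symm⟩
  obtain ⟨Y, hYA, hY⟩ := Finset.subset_set_image_iff.1 hfin.coe_toFinset.subset
  refine ⟨Y, hYA, fun a ha => ?_⟩
  have : φ a ∈ Y.image φ := by rw [hY]; exact hfin.mem_toFinset.2 ⟨a, ha, rfl⟩
  obtain ⟨y, hy, hya⟩ := Finset.mem_image.1 this
  refine ⟨y, hy, fun ξ hξ => ?_⟩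
  have hle : Submodule.span ℝ b ≤ LinearMap.ker (ContinuousLinearMap.apply ℝ ℝ (a - y)).toLinearMap := by
    refine Submodule.span_le.2 fun ζ hζ => ?_
    have := congrFun hya ⟨ζ, hζ⟩
    simp only [φ] at this
    simp [this]
  have := hle (hspan ▸ Submodule.subset_span hξ)
  simpa using this

/-- A single line is in general a null set, so the derivative cannot be integrated along it.
Averages over balls are constant along `h` instead, and continuity returns to the point `w`. -/
theorem LipschitzOnWith.add_eq_of_ae_hasLineDerivAt_zero [FiniteDimensional ℝ E]
    [MeasurableSpace E] [BorelSpace E] {μ : Measure E} [μ.IsAddHaarMeasure] {f : E → ℝ} {h : E}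
    (hlip : ∀ R : ℝ, ∃ C, LipschitzOnWith C f (Metric.closedBall 0 R))
    (hae : ∀ᵐ x ∂μ, HasLineDerivAt ℝ f 0 x h) (w : E) : f (w + h) = f w := by
  have hcont : Continuous f := by
    refine continuous_iff_continuousAt.2 fun x => ?_
    obtain ⟨C, hC⟩ := hlip (‖x‖ + 1)
    refine hC.continuousOn.continuousAt (Metric.isOpen_ball.mem_nhds
      (x := x) (s := Metric.ball (0 : E) (‖x‖ + 1)) ?_ |> fun h =>
        mem_of_superset h Metric.ball_subset_closedBall)
    simp
  have hint : ∀ (r s : ℝ), IntegrableOn (fun x => f (x + s • h)) (Metric.ball w r) μ := by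
    intro r s
    exact ((hcont.comp (by fun_prop : Continuous fun x : E => x + s • h)).continuousOn.integrableOn_compact
      (isCompact_closedBall w r)).mono_set Metric.ball_subset_closedBall
  have hconst : ∀ r : ℝ, ∫ x in Metric.ball w r, f (x + h) ∂μ = ∫ x in Metric.ball w r, f x ∂μ := by
    intro r
    have hd : ∀ s : ℝ, HasDerivAt (fun s : ℝ => ∫ x in Metric.ball w r, f (x + s • h) ∂μ) 0 s := by
      intro s₀
      obtain ⟨C, hC⟩ := hlip (‖w‖ + r + (|s₀| + 1) * ‖h‖)
      have hkey := hasDerivAt_integral_of_dominated_loc_of_lip (𝕜 := ℝ)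
        (μ := μ.restrict (Metric.ball w r)) (F := fun s x => f (x + s • h)) (F' := fun _ => 0)
        (x₀ := s₀) (s := Metric.ball s₀ 1) (bound := fun _ => C * ‖h‖)
        (Metric.ball_mem_nhds _ one_pos)
        (Eventually.of_forall fun s => (hint r s).aestronglyMeasurable) (hint r s₀)
        aestronglyMeasurable_const ?_ ?_ ?_
      · simpa using hkey.2
      · refine (ae_restrict_iff' measurableSet_ball).2 (Eventually.of_forall fun x hx => ?_)
        refine LipschitzOnWith.of_dist_le_mul fun s hs t ht => ?_
        have hmem : ∀ s ∈ Metric.ball s₀ 1, x + s • h ∈ Metric.closedBall (0 : E)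
            (‖w‖ + r + (|s₀| + 1) * ‖h‖) := by
          intro s hs
          have h1 : ‖x‖ ≤ ‖w‖ + r := by
            have := norm_sub_norm_le x w
            rw [Metric.mem_ball, dist_eq_norm] at hx
            linarith
          have h2 : |s| ≤ |s₀| + 1 := by
            have := abs_sub_abs_le_abs_sub s s₀
            rw [Metric.mem_ball, Real.dist_eq] at hs
            linarith
          rw [mem_closedBall_zero_iff]
          refine (norm_add_le _ _).trans ?_
          rw [norm_smul, Real.norm_eq_abs]
          gcongr
        refine (hC.dist_le_mul _ (hmem s hs) _ (hmem t ht)).trans (le_of_eq ?_)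
        rw [dist_add_left, dist_eq_norm, ← sub_smul, norm_smul, Real.dist_eq, Real.norm_eq_abs]
        have : ((Real.nnabs (C * ‖h‖) : NNReal) : ℝ) = C * ‖h‖ := by
          rw [Real.coe_nnabs, abs_of_nonneg (by positivity)]
        rw [this]
        ring
      · exact integrableOn_const (by simpa using (measure_ball_lt_top (μ := μ)).ne)
      · refine ae_restrict_of_ae ?_
        have := (measurePreserving_add_right μ (s₀ • h)).quasiMeasurePreserving.ae hae
        filter_upwards [this] with x hx
        have hx' : HasDerivAt (fun t : ℝ => f (x + s₀ • h + t • h)) 0 (s₀ - s₀) := by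
          rw [sub_self]; exact hx
        refine (hx'.comp_sub_const s₀ s₀).congr_of_eventuallyEq (Eventually.of_forall fun t => ?_)
        simp only [add_assoc, ← add_smul]
        congr 3
        ring
    have := is_const_of_deriv_eq_zero (fun s => (hd s).differentiableAt) (fun s => (hd s).deriv) 1 0
    simpa using this
  -- On a small ball `f (x + h) - f x` stays within `|c| / 2` of `c`, so its integral could not
  -- vanish.
  by_contra hne
  set c := f (w + h) - f w with hc
  have hc0 : 0 < |c| := abs_pos.2 (sub_ne_zero.2 hne)
  have hg : Continuous fun x => f (x + h) - f x := by fun_prop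
  obtain ⟨r, hr, hball⟩ := Metric.continuousAt_iff.1 (hg.continuousAt (x := w)) (|c| / 2) (half_pos hc0)
  have h0 : ∫ x in Metric.ball w r, (f (x + h) - f x) ∂μ = 0 := by
    have h1 := hint r 1
    have h2 := hint r 0
    simp only [one_smul, zero_smul, add_zero] at h1 h2
    rw [integral_sub h1 h2, hconst r, sub_self]
  have hfin := measure_ball_lt_top (μ := μ) (x := w) (r := r)
  have h3 : ‖∫ x in Metric.ball w r, (f (x + h) - f x - c) ∂μ‖ ≤ |c| / 2 * μ.real (Metric.ball w r) :=
    norm_setIntegral_le_of_norm_le_const hfin fun x hx => (hball hx).le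
  have hi : IntegrableOn (fun x => f (x + h) - f x) (Metric.ball w r) μ := by
    have h1 := hint r 1
    have h2 := hint r 0
    simp only [one_smul, zero_smul, add_zero] at h1 h2
    exact h1.sub h2
  rw [integral_sub hi (integrableOn_const hfin.ne), h0, setIntegral_const, zero_sub, norm_neg,
    norm_smul, Real.norm_eq_abs, Real.norm_eq_abs, abs_of_nonneg measureReal_nonneg] at h3
  have hpos : 0 < μ.real (Metric.ball w r) :=
    ENNReal.toReal_pos (Metric.measure_ball_pos μ w hr).ne' hfin.ne
  nlinarith

end LineDerivative

/-! ### Invariant translations and gradients of norm powers -/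

section NormPower

variable {E : Type*} [NormedAddCommGroup E] {p : ℝ}

theorem powDiff_zero_right (hp : p ≠ 0) (l : E) : powDiff p l 0 = ‖l‖ ^ p := by
  simp [powDiff, Real.zero_rpow hp]

theorem lipschitzOnWith_norm_rpow (hp : 1 ≤ p) (R : ℝ) :
    ∃ C, LipschitzOnWith C (fun x : E => ‖x‖ ^ p) (Metric.closedBall 0 R) := by
  refine ⟨Real.toNNReal (p * R ^ (p - 1)) * 1, ?_⟩
  have h1 : LipschitzOnWith (Real.toNNReal (p * R ^ (p - 1))) (fun t : ℝ => t ^ p)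
      (Set.Icc 0 R) := by
    refine (convex_Icc 0 R).lipschitzOnWith_of_nnnorm_hasDerivWithin_le
      (f' := fun t => p * t ^ (p - 1))
      (fun t _ => (Real.hasDerivAt_rpow_const (Or.inr hp)).hasDerivWithinAt) fun t ht => ?_
    rw [← NNReal.coe_le_coe, coe_nnnorm, Real.norm_eq_abs, Real.coe_toNNReal']
    have h0 : 0 ≤ p * t ^ (p - 1) := mul_nonneg (by linarith) (Real.rpow_nonneg ht.1 _)
    rw [abs_of_nonneg h0]
    refine le_max_of_le_left ?_
    exact mul_le_mul_of_nonneg_left (Real.rpow_le_rpow ht.1 ht.2 (by linarith)) (by linarith)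
  exact h1.comp lipschitzWith_one_norm.lipschitzOnWith fun x hx =>
    ⟨norm_nonneg _, mem_closedBall_zero_iff.1 hx⟩

theorem lipschitzOnWith_powDiff (hp : 1 ≤ p) (l : E) (R : ℝ) :
    ∃ C, LipschitzOnWith C (powDiff p l) (Metric.closedBall 0 R) := by
  obtain ⟨C, hC⟩ := lipschitzOnWith_norm_rpow (E := E) hp R
  obtain ⟨C', hC'⟩ := lipschitzOnWith_norm_rpow (E := E) hp (R + ‖l‖)
  refine ⟨C' * 1 + C, LipschitzOnWith.sub (hC'.comp (g := fun x : E => ‖x‖ ^ p) (f := fun x => x - l)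
    (LipschitzWith.lipschitzOnWith (LipschitzWith.mk_one fun x y => by simp)) fun x hx => ?_) hC⟩
  rw [mem_closedBall_zero_iff] at *
  exact (norm_sub_le _ _).trans (by linarith)

variable [NormedSpace ℝ E]

theorem powDiff_smul (c : ℝ) (l x : E) :
    powDiff p (c • l) (c • x) = |c| ^ p * powDiff p l x := by
  unfold powDiff
  rw [← smul_sub, norm_smul, norm_smul, Real.norm_eq_abs,
    Real.mul_rpow (abs_nonneg _) (norm_nonneg _), Real.mul_rpow (abs_nonneg _) (norm_nonneg _)]
  ring

theorem powDiff_eq_smul {c : ℝ} (hc : c ≠ 0) (l x : E) :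
    powDiff p l x = |c| ^ p * powDiff p (c⁻¹ • l) (c⁻¹ • x) := by
  rw [← powDiff_smul, smul_inv_smul₀ hc, smul_inv_smul₀ hc]

/-- The translations that leave all functions `powDiff p l` with `l ∈ M` invariant. -/
def invariantSubmodule (p : ℝ) (M : Submodule ℝ E) : Submodule ℝ E where
  carrier := {h | ∀ l ∈ M, ∀ w, powDiff p l (w + h) = powDiff p l w}
  add_mem' := fun {a b} ha hb l hl w => by rw [← add_assoc, hb l hl, ha l hl]
  zero_mem' := fun l _ w => by rw [add_zero]
  smul_mem' := fun c h hh l hl w => by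
    rcases eq_or_ne c 0 with rfl | hc
    · simp
    · rw [powDiff_eq_smul hc, powDiff_eq_smul hc l w, smul_add, inv_smul_smul₀ hc,
        hh _ (M.smul_mem _ hl)]

theorem eq_zero_of_mem_invariantSubmodule_top (hp : 0 < p) {h : E}
    (hh : h ∈ invariantSubmodule p (⊤ : Submodule ℝ E)) : h = 0 := by
  have := hh h trivial 0
  rw [powDiff_zero_right hp.ne'] at this
  simp only [powDiff, zero_add, sub_self, norm_zero, Real.zero_rpow hp.ne'] at this
  by_contra hne
  have := Real.rpow_pos_of_pos (norm_pos_iff.2 hne) p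
  linarith

/-- Translation invariance near the origin implies global translation invariance. -/
theorem mem_invariantSubmodule_of_eventually {M : Submodule ℝ E} {h : E}
    (hh : ∀ᶠ w in 𝓝 (0 : E), ∀ l ∈ M, powDiff p l (w + h) = powDiff p l w) :
    h ∈ invariantSubmodule p M := by
  obtain ⟨r, hr, hball⟩ := Metric.eventually_nhds_iff_ball.1 hh
  -- By homogeneity, `(1 + ε) • h` is also an invariant translation near `0`. Comparing it with `h`
  -- leaves the small translation `ε • h`, which rescaling turns into a global statement.
  have hsmall : ∀ ε : ℝ, 0 < ε → ε * ‖h‖ < r / 2 → ∀ w : E, ‖w‖ < r / 2 → ∀ l ∈ M,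
      powDiff p l (w + ε • h) = powDiff p l w := by
    intro ε hε hεh w hw l hl
    have hs : 0 < 1 + ε := by linarith
    have h1 : powDiff p l (w + (1 + ε) • h) = powDiff p l w := by
      rw [powDiff_eq_smul hs.ne', powDiff_eq_smul hs.ne' l w, smul_add, inv_smul_smul₀ hs.ne',
        hball _ _ _ (M.smul_mem _ hl)]
      rw [mem_ball_zero_iff, norm_smul, norm_inv, Real.norm_eq_abs, abs_of_pos hs]
      calc (1 + ε)⁻¹ * ‖w‖ ≤ 1 * ‖w‖ := by
            gcongr
            exact inv_le_one_of_one_le₀ (by linarith)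
        _ < r := by linarith
    have h2 : powDiff p l (w + ε • h + h) = powDiff p l (w + ε • h) := by
      refine hball _ ?_ l hl
      rw [mem_ball_zero_iff]
      calc ‖w + ε • h‖ ≤ ‖w‖ + ‖ε • h‖ := norm_add_le _ _
        _ = ‖w‖ + ε * ‖h‖ := by rw [norm_smul, Real.norm_eq_abs, abs_of_pos hε]
        _ < r := by linarith
    rw [← h2, ← h1]
    congr 1
    module
  intro l hl w
  obtain ⟨R, hR⟩ := exists_gt (max (‖h‖ / (r / 2)) (‖w‖ / (r / 2)))
  have hR0 : 0 < R := lt_of_le_of_lt (le_max_of_le_left (by positivity)) hR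
  have hR1 : ‖h‖ / (r / 2) < R := (le_max_left _ _).trans_lt hR
  have hR2 : ‖w‖ / (r / 2) < R := (le_max_right _ _).trans_lt hR
  rw [div_lt_iff₀ (by positivity)] at hR1 hR2
  rw [powDiff_eq_smul hR0.ne', powDiff_eq_smul hR0.ne' l w, smul_add,
    hsmall R⁻¹ (by positivity) _ _ _ _ (M.smul_mem _ hl)]
  · rwa [inv_mul_lt_iff₀ hR0]
  · rwa [norm_smul, norm_inv, Real.norm_eq_abs, abs_of_pos hR0, inv_mul_lt_iff₀ hR0]

/-- The gradients of the `p`-th power of the norm. -/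
def IsNormPowGrad (p : ℝ) (w : E) (ξ : E →L[ℝ] ℝ) : Prop :=
  HasFDerivAt (fun x : E => ‖x‖ ^ p) ξ w

/-- The gradients of the functions `powDiff p l` with `l ∈ M`. -/
def powDiffGrads (p : ℝ) (M : Submodule ℝ E) : Set (E →L[ℝ] ℝ) :=
  {η | ∃ w, ∃ l ∈ M, ∃ ξ ξ', IsNormPowGrad p (w - l) ξ ∧ IsNormPowGrad p w ξ' ∧ η = ξ - ξ'}

theorem IsNormPowGrad.hasFDerivAt_powDiff {w l : E} {ξ ξ' : E →L[ℝ] ℝ}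
    (h : IsNormPowGrad p (w - l) ξ) (h' : IsNormPowGrad p w ξ') :
    HasFDerivAt (powDiff p l) (ξ - ξ') w := by
  have hs : HasFDerivAt (fun x : E => x - l) (ContinuousLinearMap.id ℝ E) w :=
    (hasFDerivAt_id w).sub_const l
  have hc : HasFDerivAt (fun x : E => ‖x - l‖ ^ p) ξ w :=
    HasFDerivAt.comp (f := fun x : E => x - l) (g := fun x : E => ‖x‖ ^ p) w h hs
  exact hc.sub h'

variable [FiniteDimensional ℝ E] [MeasurableSpace E] [BorelSpace E]

theorem ae_exists_isNormPowGrad (hp : 1 ≤ p) :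
    ∀ᵐ w ∂(Measure.addHaar : Measure E), ∃ ξ, IsNormPowGrad p w ξ := by
  filter_upwards [lipschitzWith_one_norm.ae_differentiableAt (E := E)] with w hw
  exact ⟨_, (hw.rpow_const (Or.inr hp)).hasFDerivAt⟩

theorem ae_exists_isNormPowGrad_sub (hp : 1 ≤ p) (l : E) :
    ∀ᵐ w ∂(Measure.addHaar : Measure E), ∃ ξ, IsNormPowGrad p (w - l) ξ :=
  (measurePreserving_sub_right (Measure.addHaar : Measure E) l).quasiMeasurePreserving.ae
    (p := fun w => ∃ ξ, IsNormPowGrad p w ξ) (ae_exists_isNormPowGrad hp)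

/-- By Rademacher's theorem, `powDiff p l` has a gradient almost everywhere, and its derivative
along `h` is then zero almost everywhere. -/
theorem mem_invariantSubmodule_of_grads (hp : 1 ≤ p) {M : Submodule ℝ E} {h : E}
    (hh : ∀ η ∈ powDiffGrads p M, η h = 0) : h ∈ invariantSubmodule p M := by
  intro l hl w
  refine LipschitzOnWith.add_eq_of_ae_hasLineDerivAt_zero (μ := Measure.addHaar)
    (lipschitzOnWith_powDiff hp l) ?_ w
  filter_upwards [ae_exists_isNormPowGrad hp, ae_exists_isNormPowGrad_sub hp l] with x ⟨ξ', hξ'⟩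
    ⟨ξ, hξ⟩
  have := (hξ.hasFDerivAt_powDiff hξ').hasLineDerivAt h
  rwa [hh _ ⟨x, l, hl, ξ, ξ', hξ, hξ', rfl⟩] at this

end NormPower

theorem eLpNorm_rpow_eq_lintegral {E : Type*} [NormedAddCommGroup E] [MeasurableSpace E] {p : ℝ}
    (hp : 1 ≤ p) (μ : Measure E) (f : E → E) :
    eLpNorm f (ENNReal.ofReal p) μ ^ p = ∫⁻ x, ‖f x‖ₑ ^ p ∂μ := by
  have hp0 : 0 < p := by linarith
  rw [eLpNorm_eq_lintegral_rpow_enorm_toReal (by simpa using hp0) ENNReal.ofReal_ne_top,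
    ENNReal.toReal_ofReal hp0.le, ← ENNReal.rpow_mul, one_div, inv_mul_cancel₀ hp0.ne',
    ENNReal.rpow_one]


/-! ### Finitely supported measures on fixed translates -/

section FixedMeasures

variable {E : Type*} [NormedAddCommGroup E] [MeasurableSpace E] {p : ℝ}

theorem FixesMeasuresOn.fixesFinite {Φ : WassersteinSpace p E ≃ WassersteinSpace p E} {A : Set E}
    (h : FixesMeasuresOn Φ A) : FixesFinite Φ A := fun β t ht hβ =>
  h β ((Measure.support_subset_of_isClosed t.finite_toSet.isClosed hβ).trans ht)

theorem FixesMeasuresOnTranslates.fixesFinite [NormedSpace ℝ E]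
    {Φ : WassersteinSpace p E ≃ WassersteinSpace p E} {L : Submodule ℝ E}
    (h : FixesMeasuresOnTranslates Φ L) (v : E) : FixesFinite Φ (v +ᵥ (L : Set E)) :=
  (h v).fixesFinite

end FixedMeasures

theorem insert_image_add_subset_vadd {E : Type*} [NormedAddCommGroup E] [NormedSpace ℝ E]
    (v : E) (L : Submodule ℝ E) :
    insert v ((fun l => v + l) '' (L : Set E)) ⊆ v +ᵥ (L : Set E) := by
  rintro _ (rfl | ⟨l, hl, rfl⟩)
  · exact ⟨0, L.zero_mem, by simp⟩
  · exact ⟨l, hl, rfl⟩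

/-! ### Density of finitely supported measures in general position -/

section Approximation

variable {E : Type*} [NormedAddCommGroup E] [NormedSpace ℝ E] [FiniteDimensional ℝ E]
  [MeasurableSpace E] [BorelSpace E] {p : ℝ}

/-- Every point of the Wasserstein space is a limit of finitely supported measures, whose atoms
can be taken in general position. -/
theorem exists_finset_transportCost_lt (hp : 1 ≤ p) (μ : WassersteinSpace p E)
    (good : Set E → Prop)
    (hgood : ∀ (S : Finset E) (κ : E → ℕ), Set.InjOn κ S →
      ∃ᶠ e in 𝓝 (0 : E), good ((fun x => x + (κ x : ℝ) • e) '' S))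
    {η : ℝ≥0∞} (hη : η ≠ 0) :
    ∃ (S : Finset E) (μ' : WassersteinSpace p E), good S ∧ μ'.toMeasure (S : Set E)ᶜ = 0 ∧
      transportCost p μ.toMeasure μ'.toMeasure < η := by
  classical
  have : ProperSpace E := FiniteDimensional.proper_real E
  have hp0 : 0 < p := by linarith
  have hmem : MemLp (id : E → E) (ENNReal.ofReal p) μ.toMeasure := by
    refine ⟨measurable_id.aestronglyMeasurable, ?_⟩
    rw [← ENNReal.rpow_lt_top_iff_of_pos hp0, eLpNorm_rpow_eq_lintegral hp]
    simpa [edist_zero_right] using μ.lintegral_edist_rpow_lt_top hp 0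
  set η' : ℝ≥0∞ := η ^ p⁻¹ with hη'
  have hη'0 : η' ≠ 0 := by
    rw [hη', Ne, ENNReal.rpow_eq_zero_iff]
    rintro (⟨h, -⟩ | ⟨-, h⟩)
    · exact hη h
    · exact absurd h (by simp [hp0.le])
  obtain ⟨g, hg, -⟩ := hmem.exists_simpleFunc_eLpNorm_sub_lt ENNReal.ofReal_ne_top
    (ENNReal.half_pos hη'0).ne'
  -- Numbering the values and moving the value `x` by `κ x • e` displaces distinct atoms by distinct
  -- multiples of one small vector. General position then becomes a condition on `e` alone.
  obtain ⟨κ, hκ⟩ := Set.countable_iff_exists_injOn.1 g.range.finite_toSet.countable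
  set K : ℕ := g.range.sup κ with hK
  have hsmall : ∀ᶠ e in 𝓝 (0 : E), ENNReal.ofReal (K * ‖e‖) < η' / 2 := by
    have : Tendsto (fun e : E => ENNReal.ofReal (K * ‖e‖)) (𝓝 0) (𝓝 (ENNReal.ofReal (K * ‖(0 : E)‖))) :=
      ENNReal.tendsto_ofReal ((continuous_const.mul continuous_norm).tendsto _)
    refine this.eventually_lt_const ?_
    simpa using (ENNReal.half_pos hη'0)
  obtain ⟨e, hegood, hesmall⟩ := ((hgood g.range κ hκ).and_eventually hsmall).exists
  set s : E → E := fun x => g x + (κ (g x) : ℝ) • e with hs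
  have hsm : Measurable s := by
    have : Measurable fun x => (fun z : E => z + (κ z : ℝ) • e) (g x) :=
      (g.map fun z : E => z + (κ z : ℝ) • e).measurable
    exact this
  set S : Finset E := g.range.image fun x => x + (κ x : ℝ) • e with hS
  have hsS : ∀ x, s x ∈ S := fun x => Finset.mem_image_of_mem _ (g.mem_range_self x)
  have hβ : (μ.toMeasure.map s) (S : Set E)ᶜ = 0 := by
    rw [Measure.map_apply hsm S.measurableSet.compl]
    convert measure_empty (μ := μ.toMeasure)
    ext x
    simpa using hsS x
  have : IsProbabilityMeasure (μ.toMeasure.map s) := Measure.isProbabilityMeasure_map hsm.aemeasurable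
  refine ⟨S, WassersteinSpace.ofFinite hp0 (μ.toMeasure.map s) S hβ, ?_, hβ, ?_⟩
  · rw [hS, Finset.coe_image]; exact hegood
  have hc : IsCoupling (μ.toMeasure.map fun x => (x, s x)) μ.toMeasure (μ.toMeasure.map s) := by
    constructor
    · rw [Measure.map_map measurable_fst (by fun_prop)]
      exact Measure.map_id
    · rw [Measure.map_map measurable_snd (by fun_prop)]
      rfl
  refine (transportCost_le_of_coupling hc).trans_lt ?_
  rw [lintegral_map (by fun_prop) (by fun_prop)]
  have hle : eLpNorm (id - s) (ENNReal.ofReal p) μ.toMeasure < η' := by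
    have hsplit : (id - s : E → E) = (id - ⇑g) - fun x => (κ (g x) : ℝ) • e := by
      ext x; simp [hs, sub_sub]
    have hm2 : Measurable fun x => (κ (g x) : ℝ) • e :=
      (g.map fun z : E => (κ z : ℝ) • e).measurable
    rw [hsplit]
    refine (eLpNorm_sub_le (measurable_id.sub g.measurable).aestronglyMeasurable
      hm2.aestronglyMeasurable (by simpa using hp)).trans_lt ?_
    rw [← ENNReal.add_halves η']
    refine ENNReal.add_lt_add hg (lt_of_le_of_lt ?_ hesmall)
    have := eLpNorm_le_of_ae_bound (p := ENNReal.ofReal p) (μ := μ.toMeasure) (C := K * ‖e‖)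
      (f := fun x => (κ (g x) : ℝ) • e) (Eventually.of_forall fun x => ?_)
    · simpa using this
    · rw [norm_smul, Real.norm_eq_abs, Nat.abs_cast]
      gcongr
      exact Finset.le_sup (g.mem_range_self x)
  have := (ENNReal.rpow_lt_rpow_iff hp0).2 hle
  rw [eLpNorm_rpow_eq_lintegral hp, hη', ENNReal.rpow_inv_rpow hp0.ne'] at this
  simpa [edist_eq_enorm_sub] using this

end Approximation

theorem WassersteinSpace.measure_compl_supp {E : Type*} [NormedAddCommGroup E] [NormedSpace ℝ E]
    [FiniteDimensional ℝ E] [MeasurableSpace E] {p : ℝ} (μ : WassersteinSpace p E) :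
    μ.toMeasure μ.suppᶜ = 0 := by
  have : ProperSpace E := FiniteDimensional.proper_real E
  exact Measure.measure_compl_support

/-! ### Images of finitely supported measures live on finitely many cosets -/

section FiniteImage

variable {E : Type*} [NormedAddCommGroup E] [NormedSpace ℝ E] [FiniteDimensional ℝ E]
  [MeasurableSpace E] [BorelSpace E] {p : ℝ}

/-- Gradients cannot tell a point of the support of `Φ μ` apart from all atoms of `μ`. -/
theorem exists_grad_apply_eq_of_mem_supp_apply (hp : 1 ≤ p)
    {Φ : WassersteinSpace p E ≃ WassersteinSpace p E} (hΦ : IsWassersteinIsometry Φ)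
    {M : Submodule ℝ E} (hfix : ∀ v l, l ∈ M → FixesFinite Φ {v, v + l})
    {μ : WassersteinSpace p E} {S : Finset E} (hμ : μ.toMeasure (S : Set E)ᶜ = 0)
    {y : E} (hy : y ∈ (Φ μ).supp) {η : E →L[ℝ] ℝ} (hη : η ∈ powDiffGrads p M) :
    ∃ s ∈ S, η y = η s := by
  have : ProperSpace E := FiniteDimensional.proper_real E
  obtain ⟨w, l, hl, ξ, ξ', hξ, hξ', rfl⟩ := hη
  refine exists_apply_eq_of_forall_exists_eq (hξ.hasFDerivAt_powDiff hξ') fun ε hε => ?_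
  -- Seen from the far base point `-(ε⁻¹ • w)` with increment `ε⁻¹ • l`, homogeneity makes the
  -- difference at `y` a multiple of `powDiff p l (w + ε • y)`.
  obtain ⟨s, hs, h⟩ := exists_powDiff_eq_of_mem_supp_apply hp hΦ (-(ε⁻¹ • w)) {ε⁻¹ • l}
    (by simpa using hfix (-(ε⁻¹ • w)) _ (M.smul_mem ε⁻¹ hl)) hμ hy
  refine ⟨s, hs, ?_⟩
  have := h _ rfl
  rw [powDiff_eq_smul hε.ne', powDiff_eq_smul hε.ne' l (w + ε • s), smul_add, smul_add,
    inv_smul_smul₀ hε.ne', inv_smul_smul₀ hε.ne']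
  rw [sub_neg_eq_add, sub_neg_eq_add] at this
  rw [add_comm _ y, add_comm _ s, this]

theorem exists_finset_supp_apply (hp : 1 ≤ p)
    {Φ : WassersteinSpace p E ≃ WassersteinSpace p E} (hΦ : IsWassersteinIsometry Φ)
    {M : Submodule ℝ E} (hfix : ∀ v l, l ∈ M → FixesFinite Φ {v, v + l})
    {μ : WassersteinSpace p E} {S : Finset E} (hμ : μ.toMeasure (S : Set E)ᶜ = 0) :
    ∃ Y : Finset E, (Y : Set E) ⊆ (Φ μ).supp ∧
      ∀ a ∈ (Φ μ).supp, ∃ y ∈ Y, a - y ∈ invariantSubmodule p M := by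
  obtain ⟨Y, hY, h⟩ := exists_finset_forall_exists_apply_sub_eq_zero (powDiffGrads p M)
    (Φ μ).supp S fun η hη y hy => exists_grad_apply_eq_of_mem_supp_apply hp hΦ hfix hμ hy hη
  refine ⟨Y, hY, fun a ha => ?_⟩
  obtain ⟨y, hy, hya⟩ := h a ha
  exact ⟨y, hy, mem_invariantSubmodule_of_grads hp hya⟩

end FiniteImage

/-! ### General position of atoms -/

section GeneralPosition

theorem frequently_forall_mem {E : Type*} [NormedAddCommGroup E] [CompleteSpace E]
     {ι : Type*} (I : Set ι)
    (hI : I.Countable) (U : ι → Set E) (hU : ∀ i ∈ I, IsOpen (U i)) (hd : ∀ i ∈ I, Dense (U i)) :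
    ∃ᶠ e in 𝓝 (0 : E), ∀ i ∈ I, e ∈ U i := by
  have := dense_biInter_of_isOpen hU hI hd
  have h0 := mem_closure_iff_frequently.1 (this 0)
  simpa only [Set.mem_iInter] using h0

variable {E : Type*} [NormedAddCommGroup E] [NormedSpace ℝ E]

theorem isOpenMap_add_smul {c : ℝ} (hc : c ≠ 0) (a : E) : IsOpenMap fun e : E => a + c • e :=
  ((Homeomorph.smulOfNeZero c hc).trans (Homeomorph.addLeft a)).isOpenMap

/-- The points that no function `powDiff p l` with `l ∈ M` tells apart from the origin. -/
def powDiffKernel (p : ℝ) (M : Submodule ℝ E) : Set E :=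
  {z | ∀ l ∈ M, powDiff p l z = powDiff p l 0}

theorem isClosed_powDiffKernel {p : ℝ} (hp : 0 ≤ p) (M : Submodule ℝ E) :
    IsClosed (powDiffKernel p M) := by
  simp only [powDiffKernel, Set.ofPred_forall]
  exact isClosed_iInter fun l => isClosed_iInter fun _ =>
    isClosed_eq (continuous_powDiff hp l) continuous_const

/-- Membership of `z` means `‖z - l‖^p = ‖z‖^p + ‖l‖^p` for all `l ∈ M`. If `z` and `z + t • m` both
belonged, each of their norms would be strictly larger than the other. -/
theorem dense_compl_powDiffKernel {p : ℝ} (hp : 0 < p) {M : Submodule ℝ E} (hM : M ≠ ⊥) :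
    Dense (powDiffKernel p M)ᶜ := by
  obtain ⟨m, hm, hm0⟩ := M.exists_mem_ne_zero_of_ne_bot hM
  intro z
  by_cases hz : z ∈ powDiffKernel p M
  · have hz' : ∀ t : ℝ, t ≠ 0 → z + t • m ∉ powDiffKernel p M := by
      intro t ht hcon
      have h1 := hz _ (M.smul_mem (-t) hm)
      have h2 := hcon _ (M.smul_mem t hm)
      rw [powDiff_zero_right hp.ne', powDiff, neg_smul, sub_neg_eq_add, norm_neg] at h1
      rw [powDiff_zero_right hp.ne', powDiff, add_sub_cancel_right] at h2
      have : 0 < ‖t • m‖ ^ p := Real.rpow_pos_of_pos (norm_pos_iff.2 (smul_ne_zero ht hm0)) p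
      linarith
    have hlim : Tendsto (fun t : ℝ => z + t • m) (𝓝[≠] 0) (𝓝 z) := by
      have : Tendsto (fun t : ℝ => z + t • m) (𝓝 0) (𝓝 (z + (0 : ℝ) • m)) :=
        (by fun_prop : Continuous fun t : ℝ => z + t • m).tendsto 0
      rw [zero_smul, add_zero] at this
      exact this.mono_left nhdsWithin_le_nhds
    exact mem_closure_of_tendsto hlim (eventually_nhdsWithin_of_forall fun t ht => hz' t ht)
  · exact subset_closure hz

/-- For each pair, the displaced difference is affine in `e` with nonzero coefficient, so the good
`e` form an open dense set. -/
theorem frequently_pairwise_sub_notMem_powDiffKernel [CompleteSpace E] {p : ℝ} (hp : 0 < p)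
    {M : Submodule ℝ E} (hM : M ≠ ⊥) (S : Finset E) (κ : E → ℕ) (hκ : Set.InjOn κ S) :
    ∃ᶠ e in 𝓝 (0 : E), ((fun x => x + (κ x : ℝ) • e) '' (S : Set E)).Pairwise
      fun x y => x - y ∉ powDiffKernel p M := by
  refine (frequently_forall_mem (S : Set E).offDiag (S.finite_toSet.offDiag.countable)
    (fun q => (fun e => (q.1 - q.2) + ((κ q.1 : ℝ) - κ q.2) • e) ⁻¹' (powDiffKernel p M)ᶜ)
    (fun q _ => (isClosed_powDiffKernel hp.le M).isOpen_compl.preimage (by fun_prop))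
    (fun q hq => (dense_compl_powDiffKernel hp hM).preimage (isOpenMap_add_smul ?_ _))).mono ?_
  · rw [sub_ne_zero, Ne, Nat.cast_inj]
    exact fun h => hq.2.2 (hκ hq.1 hq.2.1 h)
  · rintro e he _ ⟨x, hx, rfl⟩ _ ⟨y, hy, rfl⟩ hne
    have hxy : x ≠ y := fun h => hne (by rw [h])
    have := he (x, y) ⟨hx, hy, hxy⟩
    convert this using 2
    module

end GeneralPosition

/-- Invariance at `0` gives `‖h - l‖^p = ‖h‖^p + ‖l‖^p`, so no `l ∈ L` is closer to `h` than `0`. -/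
theorem invariantSubmodule_subset_nearestProj_preimage {E : Type*} [NormedAddCommGroup E]
    [NormedSpace ℝ E] {p : ℝ} (hp : 0 < p) {L : Submodule ℝ E}
    (hL : ProjectsUniquely L) :
    (invariantSubmodule p L : Set E) ⊆ nearestProj hL ⁻¹' {0} := by
  intro h hh
  refine (hL h).unique (nearestProj_spec hL h) ⟨L.zero_mem, fun l hl => ?_⟩
  have h1 := hh l hl 0
  rw [powDiff_zero_right hp.ne', zero_add, powDiff] at h1
  rw [dist_zero_right, dist_eq_norm]
  refine (Real.rpow_le_rpow_iff (norm_nonneg _) (norm_nonneg _) hp).1 ?_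
  have := Real.rpow_nonneg (norm_nonneg l) p
  linarith

/-! ### Supports spread only along invariant directions -/

section Cosets

variable {E : Type*} [NormedAddCommGroup E] [NormedSpace ℝ E] [FiniteDimensional ℝ E]
  [MeasurableSpace E] [BorelSpace E] {p : ℝ}

theorem measurableSet_sub_mem (H : Submodule ℝ E) (x : E) : MeasurableSet {z | z - x ∈ H} := by
  have : IsClosed {z | z - x ∈ H} :=
    (Submodule.closed_of_finiteDimensional H).preimage (continuous_id.sub continuous_const)
  exact this.measurableSet

/-- An atom of a finitely supported measure in general position only spreads along the invariant
directions. -/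
theorem measure_singleton_le_measure_sub_mem (hp : 1 ≤ p)
    {Φ : WassersteinSpace p E ≃ WassersteinSpace p E} (hΦ : IsWassersteinIsometry Φ)
    {M : Submodule ℝ E} (hfix : ∀ v : E, FixesFinite Φ (v +ᵥ (M : Set E)))
    {μ : WassersteinSpace p E} {S : Finset E} (hμ : μ.toMeasure (S : Set E)ᶜ = 0)
    {x : E} (hgen : ∀ s ∈ S, s ≠ x → s - x ∉ powDiffKernel p M) :
    μ.toMeasure {x} ≤ (Φ μ).toMeasure {z | z - x ∈ invariantSubmodule p M} := by
  classical
  have : ProperSpace E := FiniteDimensional.proper_real E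
  have hp0 : 0 ≤ p := by linarith
  set H := invariantSubmodule p M with hH
  set ν := (Φ μ).toMeasure with hν
  have hfix2 : ∀ v l, l ∈ M → FixesFinite Φ {v, v + l} := fun v l hl =>
    (hfix v).mono (by
      rintro _ (rfl | rfl)
      · exact ⟨0, M.zero_mem, by simp⟩
      · exact ⟨l, hl, rfl⟩)
  obtain ⟨Y₁, -, hY₁⟩ := exists_finset_supp_apply hp hΦ hfix2 hμ
  -- Only cosets of positive mass are kept, so that missing one of them costs measure.
  set Y := Y₁.filter fun y => ν {z | z - y ∈ H} ≠ 0 with hY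
  have hYfull : ν (⋃ y ∈ Y, {z | z - y ∈ H})ᶜ = 0 := by
    have hsub : (⋃ y ∈ Y, {z | z - y ∈ H})ᶜ ⊆ (Φ μ).suppᶜ ∪
        ⋃ y ∈ Y₁.filter (fun y => ν {z | z - y ∈ H} = 0), {z | z - y ∈ H} := by
      intro u hu
      by_cases hus : u ∈ (Φ μ).supp
      · right
        obtain ⟨y, hy, huy⟩ := hY₁ u hus
        refine Set.mem_biUnion (x := y) ?_ huy
        simp only [Finset.coe_filter, Set.mem_ofPred_eq]
        refine ⟨hy, by_contra fun h0 => hu (Set.mem_biUnion (x := y) ?_ huy)⟩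
        exact Finset.mem_filter.2 ⟨hy, h0⟩
      · exact Or.inl hus
    refine measure_mono_null hsub (measure_union_null (Φ μ).measure_compl_supp ?_)
    refine (measure_biUnion_null_iff (Finset.countable_toSet _)).2 fun y hy => ?_
    exact (Finset.mem_filter.1 hy).2
  have hbad : ∀ z : E, ∃ l ∈ M, z - x ∉ powDiffKernel p M →
      powDiff p l (z - x) ≠ powDiff p l 0 := by
    intro z
    by_cases hz : z - x ∈ powDiffKernel p M
    · exact ⟨0, M.zero_mem, fun h => absurd hz h⟩
    · simp only [powDiffKernel, Set.mem_ofPred_eq, not_forall] at hz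
      obtain ⟨l, hl, h⟩ := hz
      exact ⟨l, hl, fun _ => h⟩
  choose l hlM hl using hbad
  set Z := S ∪ Y with hZ
  -- The finitely many increments `l z` that separate `z` from `x` at base point `x` still do so at
  -- nearby base points.
  have hN : ∀ᶠ v in 𝓝 x, ∀ z ∈ Z, z - x ∉ powDiffKernel p M →
      powDiff p (l z) (z - v) ≠ powDiff p (l z) (x - v) := by
    refine Z.eventually_all.2 fun z _ => ?_
    by_cases hz : z - x ∈ powDiffKernel p M
    · exact Eventually.of_forall fun v h => absurd hz h
    · have hc : Continuous fun v => powDiff p (l z) (z - v) - powDiff p (l z) (x - v) :=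
        ((continuous_powDiff hp0 _).comp (by fun_prop)).sub
          ((continuous_powDiff hp0 _).comp (by fun_prop))
      have h0 : powDiff p (l z) (z - x) - powDiff p (l z) (x - x) ≠ 0 := by
        rw [sub_self, sub_ne_zero]; exact hl z hz
      filter_upwards [hc.continuousAt.eventually_ne h0] with v hv _ using sub_ne_zero.1 hv
  let idx : E → Option Z → E := fun l₀ o => o.elim l₀ fun z => l z
  have hidx : ∀ l₀ ∈ M, ∀ o, idx l₀ o ∈ M := by
    rintro l₀ hl₀ (_ | z)
    · exact hl₀
    · exact hlM z
  -- `A v l₀` is the set of points that look like `x` from `v` for all separating increments and one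
  -- free test increment `l₀`. It has equal mass under `μ` and `ν` and is a union of cosets of `H`.
  let A : E → E → Set E := fun v l₀ =>
    {u | ∀ o, powDiff p (idx l₀ o) (u - v) = powDiff p (idx l₀ o) (x - v)}
  have hAm : ∀ v l₀, MeasurableSet (A v l₀) := by
    intro v l₀
    have : IsClosed (A v l₀) := by
      simp only [A, Set.ofPred_forall]
      exact isClosed_iInter fun o => isClosed_eq
        ((continuous_powDiff hp0 _).comp (by fun_prop)) continuous_const
    exact this.measurableSet
  have hA : ∀ v, ∀ l₀ ∈ M, ν (A v l₀) = μ.toMeasure (A v l₀) := by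
    intro v l₀ hl₀
    have h := measure_powDiff_eq_apply_eq hp hΦ v (idx l₀) ((hfix v).mono ?_) μ
      (measurableSet_singleton fun o => powDiff p (idx l₀ o) (x - v))
    · simpa only [Set.mem_singleton_iff, funext_iff] using h
    · refine subset_trans (Set.insert_subset_insert ?_) (insert_image_add_subset_vadd v M)
      rintro _ ⟨o, rfl⟩
      exact ⟨_, hidx l₀ hl₀ o, rfl⟩
  have hAinv : ∀ v, ∀ l₀ ∈ M, ∀ u y, u - y ∈ H → (u ∈ A v l₀ ↔ y ∈ A v l₀) := by
    intro v l₀ hl₀ u y huy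
    refine forall_congr' fun o => ?_
    have := huy _ (hidx l₀ hl₀ o) (y - v)
    rw [show y - v + (u - y) = u - v by abel] at this
    rw [this]
  have hlow : ∀ v, ∀ l₀ ∈ M, μ.toMeasure {x} ≤ ν (A v l₀) := by
    intro v l₀ hl₀
    rw [hA v l₀ hl₀]
    exact measure_mono (Set.singleton_subset_iff.2 fun o => rfl)
  have hup : ν (A x 0) ≤ μ.toMeasure {x} := by
    rw [hA x 0 M.zero_mem]
    refine measure_mono_ae ?_
    have hS : (S : Set E) ∈ ae μ.toMeasure := hμ
    filter_upwards [hS] with s hs hsA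
    by_contra hne
    have h1 := hgen s hs hne
    have h2 := hsA (some ⟨s, Finset.mem_union_left _ hs⟩)
    rw [sub_self] at h2
    exact hl s h1 h2
  -- The neighbourhood of `x` does not depend on `l₀`, since the separating increments alone give
  -- the inclusion.
  have hsubset : ∀ᶠ v in 𝓝 x, ∀ l₀ ∈ M, A v l₀ ∩ (⋃ y ∈ Y, {z | z - y ∈ H}) ⊆ A x 0 ∩
      ⋃ y ∈ Y.filter (fun y => y - x ∈ powDiffKernel p M), {z | z - y ∈ H} := by
    filter_upwards [hN] with v hv l₀ hl₀
    rintro u ⟨hu, huY⟩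
    obtain ⟨y, hy, huy⟩ := Set.mem_iUnion₂.1 huY
    have hyA := (hAinv v l₀ hl₀ u y huy).1 hu
    have hyk : y - x ∈ powDiffKernel p M := by
      by_contra h
      exact hv y (Finset.mem_union_right _ hy) h (hyA (some ⟨y, Finset.mem_union_right _ hy⟩))
    refine ⟨(hAinv x 0 M.zero_mem u y huy).2 fun o => ?_,
      Set.mem_biUnion (x := y) (Finset.mem_filter.2 ⟨hy, hyk⟩) huy⟩
    rw [sub_self]
    exact hyk _ (hidx 0 M.zero_mem o)
  -- Up to null sets `A v l₀` lies in `A x 0`, yet `ν (A x 0) ≤ μ {x} ≤ ν (A v l₀)`. So no charged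
  -- coset inside `A x 0` can drop out of `A v l₀`, whatever `l₀` and `v` near `x`; this is
  -- invariance under `y - x` near the origin.
  have hYH : ∀ y ∈ Y, y - x ∈ powDiffKernel p M → y - x ∈ H := by
    intro y hy hyk
    have hv : ∀ᶠ v in 𝓝 x, ∀ l₀ ∈ M, powDiff p l₀ (y - v) = powDiff p l₀ (x - v) := by
      filter_upwards [hsubset] with v hv l₀ hl₀
      by_contra hne
      have hdisj : Disjoint {z | z - y ∈ H} (A v l₀) := by
        refine Set.disjoint_left.2 fun u hu huA => hne ?_
        exact (hAinv v l₀ hl₀ u y hu).1 huA none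
      have hle : ν {z | z - y ∈ H} + ν (A v l₀) ≤ ν (A v l₀) := by
        rw [← measure_union hdisj (hAm v l₀)]
        refine (measure_mono_ae ?_).trans (hup.trans (hlow v l₀ hl₀))
        have hYae : (⋃ y ∈ Y, {z | z - y ∈ H}) ∈ ae ν := hYfull
        filter_upwards [hYae] with u huY hu
        rcases hu with hu | hu
        · refine (hAinv x 0 M.zero_mem u y hu).2 fun o => ?_
          rw [sub_self]
          exact hyk _ (hidx 0 M.zero_mem o)
        · exact (hv l₀ hl₀ ⟨hu, huY⟩).1
      have h0 : ν {z | z - y ∈ H} = 0 := by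
        have h1 : ν {z | z - y ∈ H} + ν (A v l₀) ≤ 0 + ν (A v l₀) := by rwa [zero_add]
        exact le_zero_iff.1 ((ENNReal.add_le_add_iff_right (measure_ne_top _ _)).1 h1)
      exact (Finset.mem_filter.1 hy).2 h0
    refine mem_invariantSubmodule_of_eventually ?_
    have hlim : Tendsto (fun w : E => x - w) (𝓝 0) (𝓝 x) := by
      have := (by fun_prop : Continuous fun w : E => x - w).tendsto 0
      rwa [sub_zero] at this
    filter_upwards [hlim.eventually hv] with w hw l₀ hl₀
    have := hw l₀ hl₀
    rwa [sub_sub_cancel, show y - (x - w) = w + (y - x) by abel] at this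
  refine (hlow x 0 M.zero_mem).trans (measure_mono_ae ?_)
  have hYae : (⋃ y ∈ Y, {z | z - y ∈ H}) ∈ ae ν := hYfull
  filter_upwards [hYae] with u huY hu
  obtain ⟨-, hu'⟩ := hsubset.self_of_nhds 0 M.zero_mem ⟨hu, huY⟩
  obtain ⟨y, hy, huy⟩ := Set.mem_iUnion₂.1 hu'
  have := H.add_mem huy (hYH y (Finset.mem_filter.1 hy).1 (Finset.mem_filter.1 hy).2)
  rwa [sub_add_sub_cancel] at this

/-- General position makes the cosets of the atoms disjoint, and those of atoms in `C` lie in `C`,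
so the bounds for single atoms add up. -/
theorem measure_le_measure_apply_of_invariant (hp : 1 ≤ p)
    {Φ : WassersteinSpace p E ≃ WassersteinSpace p E} (hΦ : IsWassersteinIsometry Φ)
    {M : Submodule ℝ E} (hfix : ∀ v : E, FixesFinite Φ (v +ᵥ (M : Set E)))
    {μ : WassersteinSpace p E} {S : Finset E} (hμ : μ.toMeasure (S : Set E)ᶜ = 0)
    (hgen : (S : Set E).Pairwise fun x y => x - y ∉ powDiffKernel p M)
    {C : Set E} (hC : ∀ z ∈ C, ∀ h ∈ invariantSubmodule p M, z + h ∈ C) :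
    μ.toMeasure C ≤ (Φ μ).toMeasure C := by
  classical
  set T := S.filter (· ∈ C) with hT
  have h1 : μ.toMeasure C ≤ ∑ x ∈ T, μ.toMeasure {x} := by
    rw [sum_measure_singleton]
    refine measure_mono_ae ?_
    have hS : (S : Set E) ∈ ae μ.toMeasure := hμ
    filter_upwards [hS] with s hs hsC
    exact Finset.mem_filter.2 ⟨hs, hsC⟩
  have h2 : ∑ x ∈ T, μ.toMeasure {x}
      ≤ ∑ x ∈ T, (Φ μ).toMeasure {z | z - x ∈ invariantSubmodule p M} :=
    Finset.sum_le_sum fun x hx => measure_singleton_le_measure_sub_mem hp hΦ hfix hμ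
      fun s hs hne => hgen hs (Finset.mem_filter.1 hx).1 hne
  refine h1.trans (h2.trans ?_)
  rw [← measure_biUnion_finset _ fun x _ => measurableSet_sub_mem _ x]
  · refine measure_mono (Set.iUnion₂_subset fun x hx u hu => ?_)
    have := hC x (Finset.mem_filter.1 hx).2 _ hu
    rwa [add_sub_cancel] at this
  · intro x hx y hy hne
    refine Set.disjoint_left.2 fun u hux huy => ?_
    refine hgen (Finset.mem_filter.1 hx).1 (Finset.mem_filter.1 hy).1 hne fun l hl => ?_
    have := (invariantSubmodule p M).sub_mem huy hux l hl 0
    rwa [zero_add, sub_sub_sub_cancel_left] at this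

/-- An approximation `μ'` in general position has almost all its mass near `μ.supp`. Hence `Φ μ'`
has almost all its mass in an `H`-invariant thickening, and so `Φ μ`, which is close to `Φ μ'`,
gives no mass to a ball far from it. -/
theorem supp_apply_subset_closure (hp : 1 ≤ p)
    {Φ : WassersteinSpace p E ≃ WassersteinSpace p E} (hΦ : IsWassersteinIsometry Φ)
    {M : Submodule ℝ E} (hM : M ≠ ⊥) (hfix : ∀ v : E, FixesFinite Φ (v +ᵥ (M : Set E)))
    (μ : WassersteinSpace p E) :
    (Φ μ).supp ⊆ closure ((invariantSubmodule p M : Set E) + μ.supp) := by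
  have : ProperSpace E := FiniteDimensional.proper_real E
  have hp0 : 0 < p := by linarith
  intro y hy
  by_contra hcl
  set A := (invariantSubmodule p M : Set E) + μ.supp with hA
  obtain ⟨r, hr, hrA⟩ : ∃ r > 0, ∀ a ∈ A, r ≤ dist y a := by
    simpa [Metric.mem_closure_iff] using hcl
  -- Three radii must fit into `r`: the ball around `y`, its thickening, and the thickening of `A`.
  set δ := r / 3 with hδ
  have hδ0 : 0 < δ := by positivity
  set C := Metric.thickening δ A with hC
  have hCm : MeasurableSet C := Metric.isOpen_thickening.measurableSet
  have hCinv : ∀ z ∈ C, ∀ h ∈ invariantSubmodule p M, z + h ∈ C := by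
    intro z hz h hh
    obtain ⟨_, ⟨k, hk, s, hs, rfl⟩, hd⟩ := Metric.mem_thickening_iff.1 hz
    refine Metric.mem_thickening_iff.2 ⟨k + h + s,
      ⟨_, (invariantSubmodule p M).add_mem hk hh, s, hs, rfl⟩, ?_⟩
    simpa [add_right_comm k h s] using hd
  have hzero : (Φ μ).toMeasure (Metric.ball y δ) = 0 := by
    refine le_antisymm (ENNReal.le_of_forall_pos_le_add fun η hη _ => ?_) zero_le
    have hne : ENNReal.ofReal δ ^ p * (η / 2 : ℝ≥0∞) ≠ 0 := by simp [hδ0, hη.ne']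
    obtain ⟨S, μ', hS, hμ'S, hcost⟩ := exists_finset_transportCost_lt hp μ
      (fun S => S.Pairwise fun x y => x - y ∉ powDiffKernel p M)
      (fun S κ hκ => frequently_pairwise_sub_notMem_powDiffKernel hp0 hM S κ hκ) hne
    have hcost' := hcost
    rw [← hΦ.transportCost_eq hp0] at hcost'
    have h1 := measure_le_thickening_add hp0 Metric.isOpen_ball.measurableSet (A := Metric.ball y δ) hδ0 hcost'
    have h2 : Metric.thickening δ (Metric.ball y δ) ⊆ Cᶜ := by
      intro u hu huC
      obtain ⟨z, hz, huz⟩ := Metric.mem_thickening_iff.1 hu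
      obtain ⟨a, ha, hua⟩ := Metric.mem_thickening_iff.1 huC
      have := hrA a ha
      have := dist_triangle4 y z u a
      rw [Metric.mem_ball, dist_comm] at hz
      rw [dist_comm] at huz
      linarith
    have h3 := measure_le_measure_apply_of_invariant hp hΦ hfix hμ'S hS hCinv
    have h4 := measure_le_thickening_add hp0
      (A := μ.supp) (Measure.isClosed_support.measurableSet) hδ0 hcost
    have h5 : μ.toMeasure μ.supp = 1 :=
      (prob_compl_eq_zero_iff Measure.isClosed_support.measurableSet).1 μ.measure_compl_supp
    have h6 : Metric.thickening δ μ.supp ⊆ C := Metric.thickening_subset_of_subset δ fun s hs =>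
      ⟨0, (invariantSubmodule p M).zero_mem, s, hs, zero_add s⟩
    have h7 : (Φ μ').toMeasure Cᶜ ≤ η / 2 := by
      rw [prob_compl_eq_one_sub hCm, tsub_le_iff_left, ← h5]
      exact h4.trans (add_le_add_left ((measure_mono h6).trans h3) _)
    calc (Φ μ).toMeasure (Metric.ball y δ) ≤ η / 2 + η / 2 :=
          h1.trans (by gcongr; exact (measure_mono h2).trans h7)
      _ = 0 + η := by rw [ENNReal.add_halves, zero_add]
  exact ((Measure.mem_support_iff_forall _).1 hy _ (Metric.ball_mem_nhds y hδ0)).ne' hzero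

theorem exists_restrictsImages (hp : 1 ≤ p) {L : Submodule ℝ E} (hL : ProjectsUniquely L) :
    ∃ H : Submodule ℝ E, RestrictsImages p hL H := by
  rcases eq_or_ne L ⊥ with rfl | hne
  -- For `L = ⊥` no two points are ever in general position, but every point projects to `0` and the
  -- support condition is vacuous for `⊤`.
  · refine ⟨⊤, fun x _ => ?_, fun Φ _ _ μ => ?_⟩
    · exact (nearestProj_spec hL x).1
    · intro y _
      obtain ⟨s, hs⟩ : μ.supp.Nonempty := by
        by_contra h
        have h0 := μ.measure_compl_supp
        rw [Set.not_nonempty_iff_eq_empty.1 h, Set.compl_empty, measure_univ] at h0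
        exact one_ne_zero h0
      exact subset_closure ⟨y - s, trivial, s, hs, sub_add_cancel y s⟩
  · exact ⟨invariantSubmodule p L,
      invariantSubmodule_subset_nearestProj_preimage (by linarith) hL,
      fun Φ hΦ hfix μ => supp_apply_subset_closure hp hΦ hne (fun v => hfix.fixesFinite v) μ⟩

end Cosets

theorem measure_compl_eq_zero_of_support_subset {E : Type*} [TopologicalSpace E]
    [MeasurableSpace E] [SecondCountableTopology E] {α : Measure E}
    {S : Set E} (h : α.support ⊆ S) : α Sᶜ = 0 :=
  measure_mono_null (Set.compl_subset_compl.2 h) Measure.measure_compl_support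

/-! ### Finitely supported measures and their transport costs -/

section FiniteSupport

variable {E : Type*} [NormedAddCommGroup E] [MeasurableSpace E] [BorelSpace E]

theorem Measure.ext_of_finset {α β : Measure E} {S : Finset E} (hα : α (S : Set E)ᶜ = 0)
    (hβ : β (S : Set E)ᶜ = 0) (h : ∀ s ∈ S, α {s} = β {s}) : α = β := by
  classical
  have key : ∀ (γ : Measure E), γ (S : Set E)ᶜ = 0 → ∀ A : Set E,
      γ A = ∑ s ∈ S.filter (· ∈ A), γ {s} := by
    intro γ hγ A
    rw [sum_measure_singleton]
    refine measure_congr ?_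
    have hS : (S : Set E) ∈ ae γ := hγ
    filter_upwards [hS] with s hs
    have hs' : s ∈ S := hs
    refine propext ⟨fun hA => ?_, fun hA => ?_⟩
    · exact Finset.mem_filter.2 ⟨hs', hA⟩
    · exact (Finset.mem_filter.1 hA).2
  ext A _
  rw [key α hα, key β hβ]
  exact Finset.sum_congr rfl fun s hs => h s (Finset.mem_filter.1 hs).1

/-- If the image of a finitely supported measure has no new atoms and the fixed functions separate
the atoms, then the measure is fixed. -/
theorem apply_eq_of_separates [SecondCountableTopology E] {p : ℝ} (hp : 1 ≤ p)
    {Φ : WassersteinSpace p E ≃ WassersteinSpace p E} (hΦ : IsWassersteinIsometry Φ)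
    {v : E} {M : Set E} (hfix : FixesFinite Φ (insert v ((fun l => v + l) '' M)))
    {μ : WassersteinSpace p E} {S : Finset E} (hμ : μ.toMeasure (S : Set E)ᶜ = 0)
    (hμ' : (Φ μ).toMeasure (S : Set E)ᶜ = 0)
    (hsep : ∀ s ∈ S, ∀ s' ∈ S, s' ≠ s → ∃ l ∈ M, powDiff p l (s' - v) ≠ powDiff p l (s - v)) :
    Φ μ = μ := by
  refine WassersteinSpace.ext_toMeasure (Measure.ext_of_finset hμ' hμ fun s hs => ?_)
  by_cases hM : M = ∅
  · have hS : ∀ s' ∈ S, s' = s := fun s' hs' => by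
      by_contra hne
      obtain ⟨l, hl, -⟩ := hsep s hs s' hs' hne
      simp [hM] at hl
    have h1 : ∀ γ : WassersteinSpace p E, γ.toMeasure (S : Set E)ᶜ = 0 → γ.toMeasure {s} = 1 := by
      intro γ hγ
      refine (prob_compl_eq_zero_iff (measurableSet_singleton s)).1 (measure_mono_null ?_ hγ)
      exact Set.compl_subset_compl.2 fun s' hs' => hS s' hs'
    rw [h1 _ hμ, h1 _ hμ']
  obtain ⟨l₀, hl₀⟩ := Set.nonempty_iff_ne_empty.2 hM
  have hex : ∀ s' : E, ∃ l ∈ M, s' ∈ S → s' ≠ s → powDiff p l (s' - v) ≠ powDiff p l (s - v) := by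
    intro s'
    by_cases h : s' ∈ S ∧ s' ≠ s
    · obtain ⟨l, hl, h'⟩ := hsep s hs s' h.1 h.2
      exact ⟨l, hl, fun _ _ => h'⟩
    · exact ⟨l₀, hl₀, fun h1 h2 => absurd ⟨h1, h2⟩ h⟩
  choose l hlM hl using hex
  have h := measure_powDiff_eq_apply_eq hp hΦ v (fun s' : S => l s') (hfix.mono
    (Set.insert_subset_insert (by rintro _ ⟨s', rfl⟩; exact ⟨_, hlM _, rfl⟩))) μ
    (measurableSet_singleton fun s' : S => powDiff p (l s') (s - v))
  have key : ∀ γ : WassersteinSpace p E, γ.toMeasure (S : Set E)ᶜ = 0 → γ.toMeasure {s}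
      = γ.toMeasure {x | (fun i : S => powDiff p (l i) (x - v))
        ∈ ({fun s' : S => powDiff p (l s') (s - v)} : Set (S → ℝ))} := by
    intro γ hγ
    refine measure_congr ?_
    have hS : (S : Set E) ∈ ae γ.toMeasure := hγ
    filter_upwards [hS] with s' hs'
    refine propext ⟨fun hA => ?_, fun hA => ?_⟩
    · obtain rfl : s' = s := hA
      rfl
    · by_contra hne
      exact hl s' hs' hne (congrFun hA ⟨s', hs'⟩)
  rw [key _ hμ, key _ hμ', h]

/-- The measure with mass `n a` at the point `z a`. -/
noncomputable def discreteMeasure {κ : Type*} [Fintype κ] (z : κ → E) (n : κ → ℝ) : Measure E :=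
  ∑ a, ENNReal.ofReal (n a) • Measure.dirac (z a)

variable {κ : Type*} [Fintype κ] {z : κ → E} {n : κ → ℝ}

theorem lintegral_discreteMeasure (z : κ → E) (n : κ → ℝ) (f : E → ℝ≥0∞) :
    ∫⁻ x, f x ∂(discreteMeasure z n) = ∑ a, ENNReal.ofReal (n a) * f (z a) := by
  simp [discreteMeasure, lintegral_smul_measure]

theorem discreteMeasure_apply (z : κ → E) (n : κ → ℝ) (A : Set E) [DecidablePred (· ∈ A)] :
    discreteMeasure z n A = ∑ a, if z a ∈ A then ENNReal.ofReal (n a) else 0 := by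
  simp [discreteMeasure, Set.indicator_apply]

theorem isProbabilityMeasure_discreteMeasure (hn : ∀ a, 0 ≤ n a) (h1 : ∑ a, n a = 1) :
    IsProbabilityMeasure (discreteMeasure z n) := by
  classical
  constructor
  rw [discreteMeasure_apply]
  simp [← ENNReal.ofReal_sum_of_nonneg fun a _ => hn a, h1]

theorem discreteMeasure_compl [DecidableEq E] (z : κ → E) (n : κ → ℝ) :
    discreteMeasure z n ((Finset.univ.image z : Finset E) : Set E)ᶜ = 0 := by
  classical
  rw [discreteMeasure_apply]
  simp

theorem discreteMeasure_singleton (hz : Function.Injective z) (n : κ → ℝ) (a : κ) :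
    discreteMeasure z n {z a} = ENNReal.ofReal (n a) := by
  classical
  rw [discreteMeasure_apply]
  simp [hz.eq_iff]

theorem eq_discreteMeasure [DecidableEq E] (hz : Function.Injective z) {γ : Measure E}
    [IsProbabilityMeasure γ] (hγ : γ ((Finset.univ.image z : Finset E) : Set E)ᶜ = 0) :
    γ = discreteMeasure z fun a => γ.real {z a} := by
  refine Measure.ext_of_finset hγ (discreteMeasure_compl _ _) fun s hs => ?_
  obtain ⟨a, -, rfl⟩ := Finset.mem_image.1 hs
  rw [discreteMeasure_singleton hz, ofReal_measureReal]

variable [SecondCountableTopology E] {p : ℝ}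

theorem transportCost_discreteMeasure_le (hp : 0 ≤ p) {n' : κ → ℝ} (q : κ → κ → ℝ)
    (hq : ∀ a b, 0 ≤ q a b) (hn : ∀ a, ∑ b, q a b = n a) (hn' : ∀ b, ∑ a, q a b = n' b) :
    transportCost p (discreteMeasure z n) (discreteMeasure z n')
      ≤ ENNReal.ofReal (∑ a, ∑ b, q a b * ‖z a - z b‖ ^ p) := by
  set π : Measure (E × E) := ∑ a, ∑ b, ENNReal.ofReal (q a b) • Measure.dirac (z a, z b) with hπ
  have hc : IsCoupling π (discreteMeasure z n) (discreteMeasure z n') := by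
    classical
    constructor
    · ext A hA
      rw [Measure.map_apply measurable_fst hA, discreteMeasure_apply]
      simp only [hπ, Measure.coe_finsetSum, Finset.sum_apply, Measure.smul_apply,
        Measure.dirac_apply' _ (measurable_fst hA), Set.indicator_apply, Set.mem_preimage,
        Pi.one_apply, smul_eq_mul, mul_ite, mul_one, mul_zero]
      refine Finset.sum_congr rfl fun a _ => ?_
      split_ifs
      · rw [← hn, ENNReal.ofReal_sum_of_nonneg fun b _ => hq _ b]
      · simp
    · ext A hA
      rw [Measure.map_apply measurable_snd hA, discreteMeasure_apply, hπ, Finset.sum_comm]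
      simp only [Measure.coe_finsetSum, Finset.sum_apply, Measure.smul_apply,
        Measure.dirac_apply' _ (measurable_snd hA), Set.indicator_apply, Set.mem_preimage,
        Pi.one_apply, smul_eq_mul, mul_ite, mul_one, mul_zero]
      refine Finset.sum_congr rfl fun b _ => ?_
      split_ifs
      · rw [← hn', ENNReal.ofReal_sum_of_nonneg fun a _ => hq a _]
      · simp
  refine (transportCost_le_of_coupling hc).trans (le_of_eq ?_)
  simp only [hπ, lintegral_finsetSum_measure, lintegral_smul_measure, lintegral_dirac, smul_eq_mul]
  have hnn : ∀ a b, 0 ≤ q a b * ‖z a - z b‖ ^ p := fun a b =>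
    mul_nonneg (hq a b) (Real.rpow_nonneg (norm_nonneg _) _)
  rw [ENNReal.ofReal_sum_of_nonneg fun a _ => Finset.sum_nonneg fun b _ => hnn a b]
  refine Finset.sum_congr rfl fun a _ => ?_
  rw [ENNReal.ofReal_sum_of_nonneg fun b _ => hnn a b]
  refine Finset.sum_congr rfl fun b _ => ?_
  rw [ENNReal.ofReal_mul (hq a b), edist_rpow_eq_ofReal hp]

/-- Weak Kantorovich duality: the infimal convolution `F` with the cost extends `f` from the points
`z a` to a potential on `E`, and `hlip` says exactly that the extension does not lower `f`. -/
theorem sum_mul_le_of_transportCost_le (hp : 0 < p) {n' : κ → ℝ} (hn : ∀ a, 0 ≤ n a)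
    (hn' : ∀ a, 0 ≤ n' a) (f : κ → ℝ) (hf : ∀ a, 0 ≤ f a)
    (hlip : ∀ a b, f a ≤ f b + ‖z b - z a‖ ^ p) {K : ℝ} (hK : 0 ≤ K)
    (h : transportCost p (discreteMeasure z n) (discreteMeasure z n') ≤ ENNReal.ofReal K) :
    ∑ a, n' a * f a ≤ ∑ a, n a * f a + K := by
  classical
  set F : E → ℝ≥0∞ := fun x => ⨅ a, (ENNReal.ofReal (f a) + edist (z a) x ^ p) with hF
  have hFm : Measurable F := Measurable.iInf fun a => by fun_prop
  have hnn : ∀ y : E, 0 ≤ ‖y‖ ^ p := fun y => Real.rpow_nonneg (norm_nonneg _) _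
  have hFz : ∀ a, F (z a) = ENNReal.ofReal (f a) := by
    intro a
    refine le_antisymm ((iInf_le _ a).trans ?_) (le_iInf fun b => ?_)
    · simp [hp]
    · rw [edist_rpow_eq_ofReal hp.le, ← ENNReal.ofReal_add (hf b) (hnn _)]
      exact ENNReal.ofReal_le_ofReal (hlip a b)
  have hle : ∫⁻ y, F y ∂(discreteMeasure z n')
      ≤ ∫⁻ x, F x ∂(discreteMeasure z n) + transportCost p (discreteMeasure z n)
        (discreteMeasure z n') := by
    simp only [transportCost, ENNReal.add_iInf]
    refine le_iInf₂ fun π hπ => ?_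
    have hae : ∀ᵐ w ∂π, w.1 ∈ ((Finset.univ.image z : Finset E) : Set E) := by
      have : ∀ᵐ x ∂(π.map Prod.fst), x ∈ ((Finset.univ.image z : Finset E) : Set E) := by
        rw [hπ.1]; exact discreteMeasure_compl z n
      exact ae_of_ae_map measurable_fst.aemeasurable this
    conv_lhs => rw [← hπ.2, lintegral_map hFm measurable_snd]
    conv_rhs => rw [← hπ.1, lintegral_map hFm measurable_fst, ← lintegral_add_right _ (by fun_prop)]
    refine lintegral_mono_ae ?_
    filter_upwards [hae] with w hw
    obtain ⟨a, -, ha⟩ := Finset.mem_image.1 (Finset.mem_coe.1 hw)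
    rw [← ha, hFz]
    exact iInf_le _ a
  have hle' := hle.trans (add_le_add_right h _)
  simp only [lintegral_discreteMeasure, hFz, ← ENNReal.ofReal_mul (hn _),
    ← ENNReal.ofReal_mul (hn' _)] at hle'
  rw [← ENNReal.ofReal_sum_of_nonneg fun a _ => mul_nonneg (hn a) (hf a),
    ← ENNReal.ofReal_sum_of_nonneg fun a _ => mul_nonneg (hn' a) (hf a),
    ← ENNReal.ofReal_add (Finset.sum_nonneg fun a _ => mul_nonneg (hn a) (hf a)) hK] at hle'
  exact (ENNReal.ofReal_le_ofReal_iff (add_nonneg (Finset.sum_nonneg fun a _ =>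
    mul_nonneg (hn a) (hf a)) hK)).1 hle'

end FiniteSupport

/-! ### Rigidity on a four-point grid with additive costs -/

section Grid

variable {E : Type*} [NormedAddCommGroup E] {p : ℝ}

/-- The four points form a grid whose horizontal and vertical costs `B` and `A` add up. -/
structure IsCostGrid (p : ℝ) (z : Fin 4 → E) (A B : ℝ) : Prop where
  norm_rpow : ∀ a b, ‖z a - z b‖ ^ p = (![![0, B, A, A + B], ![B, 0, A + B, A],
    ![A, A + B, 0, B], ![A + B, A, B, 0]] : Fin 4 → Fin 4 → ℝ) a b

theorem IsCostGrid.swap {z : Fin 4 → E} {A B : ℝ} (h : IsCostGrid p z A B) :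
    IsCostGrid p ![z 0, z 2, z 1, z 3] B A := by
  constructor
  intro a b
  have := h.norm_rpow
  have h0 : (0 : ℝ) ^ p = 0 := by simpa using this 0 0
  fin_cases a <;> fin_cases b <;> simp [this, h0, add_comm]

variable [MeasurableSpace E]

/-- `Φ` maps measures on the grid to measures on the grid with the same row sums and column
sums. -/
def PreservesGridMarginals (Φ : WassersteinSpace p E ≃ WassersteinSpace p E) (z : Fin 4 → E) :
    Prop :=
  ∀ (a b c d : ℝ), 0 ≤ a → 0 ≤ b → 0 ≤ c → 0 ≤ d → a + b + c + d = 1 →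
    ∀ μ : WassersteinSpace p E, μ.toMeasure = discreteMeasure z ![a, b, c, d] →
      ∃ a' b' c' d' : ℝ, 0 ≤ a' ∧ 0 ≤ b' ∧ 0 ≤ c' ∧ 0 ≤ d' ∧ a' + b' = a + b ∧ c' + d' = c + d ∧
        a' + c' = a + c ∧ b' + d' = b + d ∧
        (Φ μ).toMeasure = discreteMeasure z ![a', b', c', d']

theorem discreteMeasure_swap {E : Type*} [MeasurableSpace E] (z : Fin 4 → E) (a b c d : ℝ) :
    discreteMeasure ![z 0, z 2, z 1, z 3] ![a, b, c, d] = discreteMeasure z ![a, c, b, d] := by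
  simp only [discreteMeasure, Fin.sum_univ_four, Matrix.cons_val]
  abel

theorem PreservesGridMarginals.swap {Φ : WassersteinSpace p E ≃ WassersteinSpace p E}
    {z : Fin 4 → E} (h : PreservesGridMarginals Φ z) :
    PreservesGridMarginals Φ ![z 0, z 2, z 1, z 3] := by
  intro a b c d ha hb hc hd h1 μ hμ
  rw [discreteMeasure_swap] at hμ
  obtain ⟨a', b', c', d', ha', hb', hc', hd', e1, e2, e3, e4, hν⟩ :=
    h a c b d ha hc hb hd (by linarith) μ hμ
  exact ⟨a', c', b', d', ha', hc', hb', hd', e3, e4, e1, e2, by rw [discreteMeasure_swap, hν]⟩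

/-- The masses on a grid with row sums `(1 - T - r, T + r)` and column sums `(1 - T, T)`. -/
def gridMass (T r t : ℝ) : Fin 4 → ℝ := ![1 - T - r - t, t, r + t, T - t]

theorem gridMass_nonneg {T r t : ℝ} (hr : 0 ≤ r) (hT : r ≤ 1 - 2 * T) (ht : 0 ≤ t) (htT : t ≤ T)
    (a : Fin 4) : 0 ≤ gridMass T r t a := by
  fin_cases a <;> simp [gridMass] <;> linarith

theorem sum_gridMass (T r t : ℝ) : ∑ a, gridMass T r t a = 1 := by
  simp [gridMass, Fin.sum_univ_four]
  ring

theorem PreservesGridMarginals.exists_gridMass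
    {Φ : WassersteinSpace p E ≃ WassersteinSpace p E} {z : Fin 4 → E}
    (h : PreservesGridMarginals Φ z) {T r t : ℝ} (hr : 0 ≤ r) (hT : r ≤ 1 - 2 * T) (ht : 0 ≤ t)
    (htT : t ≤ T) {μ : WassersteinSpace p E}
    (hμ : μ.toMeasure = discreteMeasure z (gridMass T r t)) :
    ∃ t', 0 ≤ t' ∧ t' ≤ T ∧ (Φ μ).toMeasure = discreteMeasure z (gridMass T r t') := by
  obtain ⟨a', b', c', d', ha', hb', hc', hd', e1, e2, e3, e4, hν⟩ :=
    h (1 - T - r - t) t (r + t) (T - t) (by linarith) ht (by linarith) (by linarith) (by ring) μ hμ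
  refine ⟨b', hb', by linarith, ?_⟩
  rw [hν, gridMass]
  congr 2
  · linarith
  · congr 2
    · linarith
    · congr 1; linarith

variable [BorelSpace E] [SecondCountableTopology E]

theorem IsCostGrid.transportCost_gridMass_le (hp : 0 ≤ p) {z : Fin 4 → E} {A B : ℝ}
    (h : IsCostGrid p z A B) {T r t s : ℝ} (hr : 0 ≤ r) (hT : r ≤ 1 - 2 * T)
    (ht : 0 ≤ t) (htT : t ≤ T) (hs : 0 ≤ s) (hsT : s ≤ T) :
    transportCost p (discreteMeasure z (gridMass T r t)) (discreteMeasure z (gridMass T r s))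
      ≤ ENNReal.ofReal (2 * B * |t - s|) := by
  rcases le_total t s with hts | hts
  · refine (transportCost_discreteMeasure_le hp ![![1 - T - r - s, s - t, 0, 0], ![0, t, 0, 0],
      ![0, 0, r + t, 0], ![0, 0, s - t, T - s]] ?_ ?_ ?_).trans (ENNReal.ofReal_le_ofReal ?_)
    · intro a b; fin_cases a <;> fin_cases b <;> simp <;> linarith
    · intro a; fin_cases a <;> simp [Fin.sum_univ_four, gridMass]
    · intro a; fin_cases a <;> simp [Fin.sum_univ_four, gridMass]
    · simp only [h.norm_rpow, Fin.sum_univ_four, Matrix.cons_val]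
      rw [abs_of_nonpos (by linarith)]
      linarith
  · refine (transportCost_discreteMeasure_le hp ![![1 - T - r - t, 0, 0, 0], ![t - s, s, 0, 0],
      ![0, 0, r + s, t - s], ![0, 0, 0, T - t]] ?_ ?_ ?_).trans (ENNReal.ofReal_le_ofReal ?_)
    · intro a b; fin_cases a <;> fin_cases b <;> simp <;> linarith
    · intro a; fin_cases a <;> simp [Fin.sum_univ_four, gridMass]
    · intro a; fin_cases a <;> simp [Fin.sum_univ_four, gridMass]
    · simp only [h.norm_rpow, Fin.sum_univ_four, Matrix.cons_val]
      rw [abs_of_nonneg (by linarith)]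
      linarith

theorem IsCostGrid.sum_mul_le (hp : 0 < p) {z : Fin 4 → E} {A B : ℝ} (h : IsCostGrid p z A B)
    {n n' : Fin 4 → ℝ} (hn : ∀ a, 0 ≤ n a) (hn' : ∀ a, 0 ≤ n' a) {f₀ f₁ f₂ f₃ : ℝ}
    (h0 : 0 ≤ f₀) (h1 : 0 ≤ f₁) (h2 : 0 ≤ f₂) (h3 : 0 ≤ f₃)
    (h01 : |f₀ - f₁| ≤ B) (h02 : |f₀ - f₂| ≤ A) (h03 : |f₀ - f₃| ≤ A + B)
    (h12 : |f₁ - f₂| ≤ A + B) (h13 : |f₁ - f₃| ≤ A) (h23 : |f₂ - f₃| ≤ B) {K : ℝ} (hK : 0 ≤ K)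
    (hcost : transportCost p (discreteMeasure z n) (discreteMeasure z n') ≤ ENNReal.ofReal K) :
    n' 0 * f₀ + n' 1 * f₁ + n' 2 * f₂ + n' 3 * f₃
      ≤ n 0 * f₀ + n 1 * f₁ + n 2 * f₂ + n 3 * f₃ + K := by
  rw [abs_le] at *
  have := sum_mul_le_of_transportCost_le hp hn hn' ![f₀, f₁, f₂, f₃]
    (by intro a; fin_cases a <;> simpa) (by
      intro a b
      rw [h.norm_rpow]
      fin_cases a <;> fin_cases b <;> simp <;> linarith) hK hcost
  simpa [Fin.sum_univ_four] using this

/-- The two potentials equal to `B` on one diagonal and `0` on the other bound the cost below by `2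
* B * |t - s|`. They are admissible because `B ≤ A`, and they match the coupling that moves mass
only within rows. -/
theorem IsCostGrid.abs_sub_le (hp : 0 < p) {z : Fin 4 → E} {A B : ℝ} (h : IsCostGrid p z A B)
    (hB : 0 < B) (hBA : B ≤ A) {T r t s K : ℝ} (hr : 0 ≤ r) (hT : r ≤ 1 - 2 * T)
    (ht : 0 ≤ t) (htT : t ≤ T) (hs : 0 ≤ s) (hsT : s ≤ T) (hK : 0 ≤ K)
    (hcost : transportCost p (discreteMeasure z (gridMass T r t))
      (discreteMeasure z (gridMass T r s)) ≤ ENNReal.ofReal (2 * B * K)) : |t - s| ≤ K := by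
  have hn := gridMass_nonneg hr hT ht htT
  have hn' := gridMass_nonneg hr hT hs hsT
  have hK' : 0 ≤ 2 * B * K := by positivity
  have key : ∀ x : ℝ, |x| ≤ B → |x| ≤ A + B ∧ |x| ≤ A := fun x hx => ⟨by linarith, by linarith⟩
  have hBB : |B - 0| ≤ B := by rw [sub_zero, abs_of_pos hB]
  have hBB' : |0 - B| ≤ B := by rw [zero_sub, abs_neg, abs_of_pos hB]
  have h00 : |(0 : ℝ) - 0| ≤ B := by simpa using hB.le
  have h11 : |B - B| ≤ B := by simpa using hB.le
  have e1 := h.sum_mul_le hp hn hn' (f₀ := B) (f₁ := 0) (f₂ := 0) (f₃ := B) hB.le le_rfl le_rfl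
    hB.le hBB (key _ hBB).2 (key _ h11).1 (key _ h00).1 (key _ hBB').2 hBB' hK' hcost
  have e2 := h.sum_mul_le hp hn hn' (f₀ := 0) (f₁ := B) (f₂ := B) (f₃ := 0) le_rfl hB.le hB.le
    le_rfl hBB' (key _ hBB').2 (key _ h00).1 (key _ h11).1 (key _ hBB).2 hBB hK' hcost
  simp only [gridMass, Matrix.cons_val] at e1 e2
  rw [abs_le]
  constructor
  · have : B * (s - t) ≤ B * K := by linarith
    linarith [le_of_mul_le_mul_left this hB]
  · have : B * (t - s) ≤ B * K := by linarith
    linarith [le_of_mul_le_mul_left this hB]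

/-- `Φ` acts isometrically on the measures on a grid with given marginals. -/
theorem IsCostGrid.abs_sub_eq (hp : 0 < p) {Φ : WassersteinSpace p E ≃ WassersteinSpace p E}
    (hΦ : IsWassersteinIsometry Φ) {z : Fin 4 → E} {A B : ℝ} (h : IsCostGrid p z A B)
    (hB : 0 < B) (hBA : B ≤ A) {T r t s t' s' : ℝ} (hr : 0 ≤ r) (hT : r ≤ 1 - 2 * T)
    (ht : 0 ≤ t) (htT : t ≤ T) (hs : 0 ≤ s) (hsT : s ≤ T)
    (ht' : 0 ≤ t') (htT' : t' ≤ T) (hs' : 0 ≤ s') (hsT' : s' ≤ T) {μ ν : WassersteinSpace p E}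
    (hμ : μ.toMeasure = discreteMeasure z (gridMass T r t))
    (hν : ν.toMeasure = discreteMeasure z (gridMass T r s))
    (hμ' : (Φ μ).toMeasure = discreteMeasure z (gridMass T r t'))
    (hν' : (Φ ν).toMeasure = discreteMeasure z (gridMass T r s')) : |t' - s'| = |t - s| := by
  have hc := hΦ.transportCost_eq hp μ ν
  rw [hμ, hν, hμ', hν'] at hc
  refine le_antisymm ?_ ?_
  · refine h.abs_sub_le hp hB hBA hr hT ht' htT' hs' hsT' (abs_nonneg _) ?_
    rw [hc]
    exact h.transportCost_gridMass_le hp.le hr hT ht htT hs hsT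
  · refine h.abs_sub_le hp hB hBA hr hT ht htT hs hsT (abs_nonneg _) ?_
    rw [← hc]
    exact h.transportCost_gridMass_le hp.le hr hT ht' htT' hs' hsT'

theorem IsCostGrid.apply_eq_of_le (hp : 0 < p)
    {Φ : WassersteinSpace p E ≃ WassersteinSpace p E} (hΦ : IsWassersteinIsometry Φ)
    {z : Fin 4 → E} {A B : ℝ} (h : IsCostGrid p z A B) (hB : 0 < B) (hBA : B ≤ A)
    (hgrid : PreservesGridMarginals Φ z) {T : ℝ} (hT0 : 0 < T) (hT : T < 1 / 2)
    {μ : WassersteinSpace p E} (hμ : μ.toMeasure = discreteMeasure z ![1 - T, 0, 0, T]) :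
    Φ μ = μ := by
  classical
  -- The bound `1 - 2 * T` leaves room to change the row sums by `ε`; this is where `T < 1 / 2`
  -- enters. The bound `2 * ε < T` decides the first case at the end.
  obtain ⟨ε, hε0, hε1, hε2⟩ : ∃ ε : ℝ, 0 < ε ∧ ε ≤ 1 - 2 * T ∧ 2 * ε < T := by
    refine ⟨min (1 - 2 * T) (T / 3), lt_min (by linarith) (by linarith), min_le_left _ _, ?_⟩
    have := min_le_right (1 - 2 * T) (T / 3)
    linarith
  have hex : ∀ r t : ℝ, 0 ≤ r → r ≤ 1 - 2 * T → 0 ≤ t → t ≤ T →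
      ∃ ν : WassersteinSpace p E, ν.toMeasure = discreteMeasure z (gridMass T r t) := by
    intro r t hr hrT ht htT
    have := isProbabilityMeasure_discreteMeasure (z := z) (gridMass_nonneg hr hrT ht htT)
      (sum_gridMass T r t)
    exact ⟨WassersteinSpace.ofFinite hp _ _ (discreteMeasure_compl z (gridMass T r t)), rfl⟩
  have hμ0 : μ.toMeasure = discreteMeasure z (gridMass T 0 0) := by
    rw [hμ, gridMass]; simp
  have hTT : (0 : ℝ) ≤ 1 - 2 * T := by linarith
  obtain ⟨t₀, ht₀, ht₀T, hΦ₀⟩ := hgrid.exists_gridMass le_rfl hTT le_rfl hT0.le hμ0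
  obtain ⟨ν₁, hν₁⟩ := hex 0 T le_rfl hTT hT0.le le_rfl
  obtain ⟨t₁, ht₁, ht₁T, hΦ₁⟩ := hgrid.exists_gridMass le_rfl hTT hT0.le le_rfl hν₁
  have h01 := h.abs_sub_eq hp hΦ hB hBA le_rfl hTT le_rfl hT0.le hT0.le le_rfl ht₀ ht₀T ht₁ ht₁T
    hμ0 hν₁ hΦ₀ hΦ₁
  rw [zero_sub, abs_neg, abs_of_pos hT0] at h01
  -- Two points of `[0, T]` at distance `T` are its endpoints.
  have ht₀' : t₀ = 0 ∨ t₀ = T := by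
    rcases abs_choice (t₀ - t₁) with h' | h' <;> rw [h'] at h01
    · right; linarith
    · left; linarith
  rcases ht₀' with rfl | rfl
  · exact WassersteinSpace.ext_toMeasure (hΦ₀.trans hμ0.symm)
  exfalso
  -- Suppose `Φ` reflects the segment `r = 0`. Then `ν₂` goes from parameter `ε` to `T - ε`, while
  -- the endpoint `ν₃` of the segment `r = ε` stays an endpoint of that segment. The originals
  -- differ by a vertical move of mass `ε`, of cost `ε * A`; both possible images also need
  -- horizontal moves.
  obtain ⟨ν₂, hν₂⟩ := hex 0 ε le_rfl hTT hε0.le (by linarith)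
  obtain ⟨t₂, ht₂, ht₂T, hΦ₂⟩ := hgrid.exists_gridMass le_rfl hTT hε0.le (by linarith) hν₂
  have h02 := h.abs_sub_eq hp hΦ hB hBA le_rfl hTT le_rfl hT0.le hε0.le (by linarith) ht₀ ht₀T
    ht₂ ht₂T hμ0 hν₂ hΦ₀ hΦ₂
  rw [zero_sub, abs_neg, abs_of_pos hε0, abs_of_nonneg (by linarith)] at h02
  obtain rfl : t₂ = t₀ - ε := by linarith
  obtain ⟨ν₃, hν₃⟩ := hex ε 0 hε0.le hε1 le_rfl hT0.le
  obtain ⟨ν₄, hν₄⟩ := hex ε t₀ hε0.le hε1 hT0.le le_rfl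
  obtain ⟨t₃, ht₃, ht₃T, hΦ₃⟩ := hgrid.exists_gridMass hε0.le hε1 le_rfl hT0.le hν₃
  obtain ⟨t₄, ht₄, ht₄T, hΦ₄⟩ := hgrid.exists_gridMass hε0.le hε1 hT0.le le_rfl hν₄
  have h34 := h.abs_sub_eq hp hΦ hB hBA hε0.le hε1 le_rfl hT0.le hT0.le le_rfl ht₃ ht₃T ht₄ ht₄T
    hν₃ hν₄ hΦ₃ hΦ₄
  rw [zero_sub, abs_neg, abs_of_pos hT0] at h34
  have ht₃' : t₃ = 0 ∨ t₃ = t₀ := by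
    rcases abs_choice (t₃ - t₄) with h' | h' <;> rw [h'] at h34
    · right; linarith
    · left; linarith
  have hA : 0 < A := hB.trans_le hBA
  have hcost : transportCost p (discreteMeasure z (gridMass t₀ 0 (t₀ - ε)))
      (discreteMeasure z (gridMass t₀ ε t₃)) ≤ ENNReal.ofReal (ε * A) := by
    rw [← hΦ₂, ← hΦ₃, hΦ.transportCost_eq hp, hν₂, hν₃]
    refine (transportCost_discreteMeasure_le hp.le ![![1 - t₀ - ε, 0, 0, 0], ![0, 0, 0, ε],
      ![0, 0, ε, 0], ![0, 0, 0, t₀ - ε]] ?_ ?_ ?_).trans (ENNReal.ofReal_le_ofReal ?_)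
    · intro a b; fin_cases a <;> fin_cases b <;> simp <;> linarith
    · intro a; fin_cases a <;> simp [Fin.sum_univ_four, gridMass]
    · intro a; fin_cases a <;> simp [Fin.sum_univ_four, gridMass]
    · simp only [h.norm_rpow, Fin.sum_univ_four, Matrix.cons_val]
      linarith
  have hn := gridMass_nonneg le_rfl hTT ht₂ ht₂T
  have hn' := gridMass_nonneg hε0.le hε1 ht₃ ht₃T
  have hεA : 0 ≤ ε * A := by positivity
  rcases ht₃' with rfl | rfl
  -- This potential bounds the cost of the images below by `ε * A + 2 * B * (T - 2 * ε)`.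
  · have := h.sum_mul_le hp hn hn' (f₀ := B) (f₁ := 0) (f₂ := A - B) (f₃ := A) hB.le le_rfl
      (by linarith) hA.le (by rw [abs_le]; constructor <;> linarith)
      (by rw [abs_le]; constructor <;> linarith) (by rw [abs_le]; constructor <;> linarith)
      (by rw [abs_le]; constructor <;> linarith) (by rw [abs_le]; constructor <;> linarith)
      (by rw [abs_le]; constructor <;> linarith) hεA hcost
    simp only [gridMass, Matrix.cons_val] at this
    nlinarith [mul_pos hB (sub_pos.2 hε2)]
  -- Here the lower bound is `ε * A + 2 * B * ε`.
  · have := h.sum_mul_le hp hn hn' (f₀ := 0) (f₁ := B) (f₂ := A) (f₃ := A - B) le_rfl hB.le hA.le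
      (by linarith) (by rw [abs_le]; constructor <;> linarith)
      (by rw [abs_le]; constructor <;> linarith) (by rw [abs_le]; constructor <;> linarith)
      (by rw [abs_le]; constructor <;> linarith) (by rw [abs_le]; constructor <;> linarith)
      (by rw [abs_le]; constructor <;> linarith) hεA hcost
    simp only [gridMass, Matrix.cons_val] at this
    nlinarith [mul_pos hB hε0]

theorem IsCostGrid.apply_eq (hp : 0 < p)
    {Φ : WassersteinSpace p E ≃ WassersteinSpace p E} (hΦ : IsWassersteinIsometry Φ)
    {z : Fin 4 → E} {A B : ℝ} (h : IsCostGrid p z A B) (hA : 0 < A) (hB : 0 < B)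
    (hgrid : PreservesGridMarginals Φ z) {T : ℝ} (hT0 : 0 < T) (hT : T < 1 / 2)
    {μ : WassersteinSpace p E} (hμ : μ.toMeasure = discreteMeasure z ![1 - T, 0, 0, T]) :
    Φ μ = μ := by
  rcases le_total B A with hBA | hAB
  · exact h.apply_eq_of_le hp hΦ hB hBA hgrid hT0 hT hμ
  -- Exchanging rows and columns leaves the diagonal measure unchanged.
  · exact h.swap.apply_eq_of_le hp hΦ hA hAB hgrid.swap hT0 hT (by rw [discreteMeasure_swap, hμ])

end Grid

/-! ### Cosets of `H`, and two-point measures that could move -/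

section TwoPoint

variable {E : Type*} [NormedAddCommGroup E] [NormedSpace ℝ E] {p : ℝ}

/-- The hypothesis makes `‖z + n • k‖^p` affine in the integer `n`. Being nonnegative in both
directions it stays bounded, which forces `k = 0`. -/
theorem eq_zero_of_powDiff_add_eq (hp : 0 < p) {H : Submodule ℝ E} {k z : E} (hk : k ∈ H)
    (h : ∀ l ∈ H, powDiff p l (z + k) = powDiff p l z) : k = 0 := by
  have hstep : ∀ l ∈ H, ‖z - (l - k)‖ ^ p = ‖z - l‖ ^ p + (‖z + k‖ ^ p - ‖z‖ ^ p) := by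
    intro l hl
    have := h l hl
    unfold powDiff at this
    rw [show z - (l - k) = z + k - l by abel]
    linarith
  have hpos : ∀ n : ℕ, ‖z + (n : ℝ) • k‖ ^ p = ‖z‖ ^ p + n * (‖z + k‖ ^ p - ‖z‖ ^ p) := by
    intro n
    induction n with
    | zero => simp
    | succ n ih =>
      have := hstep (-((n : ℝ) • k)) (H.neg_mem (H.smul_mem _ hk))
      rw [sub_neg_eq_add, ih, show z - (-((n : ℝ) • k) - k) = z + ((n + 1 : ℕ) : ℝ) • k by
        push_cast; module] at this
      rw [this]; push_cast; ring
  have hneg : ∀ n : ℕ, ‖z - (n : ℝ) • k‖ ^ p = ‖z‖ ^ p - n * (‖z + k‖ ^ p - ‖z‖ ^ p) := by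
    intro n
    induction n with
    | zero => simp
    | succ n ih =>
      have := hstep (((n + 1 : ℕ) : ℝ) • k) (H.smul_mem _ hk)
      rw [show z - (((n + 1 : ℕ) : ℝ) • k - k) = z - (n : ℝ) • k by push_cast; module, ih] at this
      push_cast at this ⊢
      linarith
  by_contra hk0
  have hk0' : 0 < ‖k‖ := norm_pos_iff.2 hk0
  obtain ⟨n, hn⟩ := exists_nat_gt (((2 * ‖z‖ ^ p) ^ p⁻¹ + ‖z‖) / ‖k‖)
  rw [div_lt_iff₀ hk0'] at hn
  have h1 : ‖z + (n : ℝ) • k‖ ^ p ≤ 2 * ‖z‖ ^ p := by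
    have := Real.rpow_nonneg (norm_nonneg (z - (n : ℝ) • k)) p
    rw [hneg] at this
    rw [hpos]; linarith
  have h2 : ‖z + (n : ℝ) • k‖ ≤ (2 * ‖z‖ ^ p) ^ p⁻¹ :=
    (Real.le_rpow_inv_iff_of_pos (norm_nonneg _) (by positivity) hp).2 h1
  have h3 : ‖(n : ℝ) • k‖ ≤ ‖z + (n : ℝ) • k‖ + ‖z‖ := by
    simpa [add_comm] using norm_sub_le (z + (n : ℝ) • k) z
  rw [norm_smul, Real.norm_natCast] at h3
  linarith

theorem norm_sub_rpow_of_mem_invariantSubmodule (hp : p ≠ 0) {H : Submodule ℝ E} {U : E}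
    (hU : U ∈ invariantSubmodule p H) {l : E} (hl : l ∈ H) :
    ‖U - l‖ ^ p = ‖U‖ ^ p + ‖l‖ ^ p := by
  have := hU l hl 0
  rw [zero_add, powDiff_zero_right hp, powDiff] at this
  linarith

theorem isCostGrid_of_mem_invariantSubmodule (hp : p ≠ 0) {H : Submodule ℝ E} {U k : E}
    (hU : U ∈ invariantSubmodule p H) (hk : k ∈ H) (x : E) :
    IsCostGrid p ![x, x + k, x + U, x + (U + k)] (‖U‖ ^ p) (‖k‖ ^ p) := by
  have h1 : ‖U - k‖ ^ p = ‖U‖ ^ p + ‖k‖ ^ p := norm_sub_rpow_of_mem_invariantSubmodule hp hU hk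
  have h2 : ‖U + k‖ ^ p = ‖U‖ ^ p + ‖k‖ ^ p := by
    simpa using norm_sub_rpow_of_mem_invariantSubmodule hp hU (H.neg_mem hk)
  have h3 : ‖k - U‖ ^ p = ‖U‖ ^ p + ‖k‖ ^ p := by rw [norm_sub_rev, h1]
  have h4 : ‖-k + -U‖ ^ p = ‖U‖ ^ p + ‖k‖ ^ p := by
    rw [← neg_add, norm_neg, add_comm k, h2]
  constructor
  intro a b
  fin_cases a <;> fin_cases b <;>
    simp [h1, h2, h3, h4, Real.zero_rpow hp, sub_add_eq_sub_sub]

variable [MeasurableSpace E]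

theorem exists_sub_mem_of_mem_supp_apply [FiniteDimensional ℝ E]
    {Φ : WassersteinSpace p E ≃ WassersteinSpace p E}
    {H : Submodule ℝ E}
    (hsupp : ∀ μ : WassersteinSpace p E, (Φ μ).supp ⊆ closure ((H : Set E) + μ.supp))
    (μ : WassersteinSpace p E) (S : Finset E) (hμ : μ.toMeasure (S : Set E)ᶜ = 0) (y : E)
    (hy : y ∈ (Φ μ).supp) : ∃ s ∈ S, y - s ∈ H := by
  have hcl : IsClosed (⋃ s ∈ S, (fun x => x - s) ⁻¹' (H : Set E)) :=
    isClosed_biUnion_finset fun s _ =>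
      H.closed_of_finiteDimensional.preimage (continuous_id.sub continuous_const)
  have hsub : (H : Set E) + μ.supp ⊆ ⋃ s ∈ S, (fun x => x - s) ⁻¹' (H : Set E) := by
    rintro _ ⟨h, hh, s, hs, rfl⟩
    have hs' : s ∈ S := Measure.support_subset_of_isClosed S.finite_toSet.isClosed hμ hs
    simp only [Set.mem_iUnion, Set.mem_preimage, SetLike.mem_coe]
    exact ⟨s, hs', by simpa using hh⟩
  simpa using closure_minimal hsub hcl (hsupp μ hy)

variable [BorelSpace E] [SecondCountableTopology E]

variable {Φ : WassersteinSpace p E ≃ WassersteinSpace p E} {H : Submodule ℝ E}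

/-- The support of the image stays in the common coset by `hsupp`, and there the functions based at
`0` with increments in `H` separate points. So no new atoms appear and the masses agree. -/
theorem fixesFinite_vadd_of_fixesFinite (hp : 1 ≤ p) (hΦ : IsWassersteinIsometry Φ)
    (hsupp : ∀ (μ : WassersteinSpace p E) (S : Finset E), μ.toMeasure (S : Set E)ᶜ = 0 →
      ∀ y ∈ (Φ μ).supp, ∃ s ∈ S, y - s ∈ H)
    (hfix : FixesFinite Φ (H : Set E)) (v : E) : FixesFinite Φ (v +ᵥ (H : Set E)) := by
  intro μ S hS hμ
  have hfix0 : FixesFinite Φ (insert 0 ((fun l => 0 + l) '' (H : Set E))) := by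
    simpa using hfix
  have hsub : ∀ s ∈ S, ∀ s' ∈ S, s' - s ∈ H := by
    intro s hs s' hs'
    obtain ⟨h, hh, rfl⟩ := hS hs
    obtain ⟨h', hh', rfl⟩ := hS hs'
    simpa using H.sub_mem hh' hh
  refine apply_eq_of_separates hp hΦ hfix0 hμ ?_ ?_
  · refine measure_compl_eq_zero_of_support_subset fun y hy => ?_
    obtain ⟨s, hs, hs'⟩ := exists_powDiff_eq_of_mem_supp_apply hp hΦ 0 _ hfix0 hμ hy
    obtain ⟨s₀, hs₀, hy₀⟩ := hsupp μ S hμ y hy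
    have hys : y - s ∈ H := by simpa using H.add_mem hy₀ (hsub s hs s₀ hs₀)
    have := eq_zero_of_powDiff_add_eq (p := p) (z := s) (by linarith) hys
      (by simpa using hs')
    rw [sub_eq_zero.1 this]
    exact hs
  · intro s hs s' hs' hne
    by_contra! hcon
    refine hne (sub_eq_zero.1 (eq_zero_of_powDiff_add_eq (p := p) (z := s) (by linarith)
      (hsub s hs s' hs') ?_))
    simpa using hcon

/-- From every base point `y - w`, the new point `y` looks like `x₁` or `x₂`. It cannot look like
`x₁`, which lies in the same coset of `H`; looking like `x₂` for every `w` says that `x₂ - y` is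
invariant. -/
theorem exists_sub_mem_invariantSubmodule (hp : 1 ≤ p) (hΦ : IsWassersteinIsometry Φ)
    (hfix : ∀ v : E, FixesFinite Φ (v +ᵥ (H : Set E)))
    {x₁ x₂ y : E} {μ : WassersteinSpace p E} (hμ : μ.toMeasure ({x₁, x₂} : Set E)ᶜ = 0)
    (hy : y ∈ (Φ μ).supp) (hyH : y - x₁ ∈ H) (hy₁ : y ≠ x₁) :
    ∃ k ∈ H, k ≠ 0 ∧ x₂ - x₁ - k ∈ invariantSubmodule p H := by
  classical
  refine ⟨y - x₁, hyH, sub_ne_zero.2 hy₁, ?_⟩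
  have hU : x₂ - x₁ - (y - x₁) = x₂ - y := by abel
  rw [hU]
  intro l hl w
  obtain ⟨s, hs, hs'⟩ := exists_powDiff_eq_of_mem_supp_apply (S := {x₁, x₂}) hp hΦ (y - w) H
    ((hfix (y - w)).mono (insert_image_add_subset_vadd _ _)) (by simpa using hμ) hy
  rcases Finset.mem_insert.1 hs with rfl | hs
  · refine absurd (sub_eq_zero.1 (eq_zero_of_powDiff_add_eq (p := p) (z := s - (y - w))
      (by linarith) hyH fun l hl => ?_)) hy₁
    rw [← hs' l hl]; congr 1; abel
  · rw [Finset.mem_singleton.1 hs] at hs'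
    have := hs' l hl
    rw [show w + (x₂ - y) = x₂ - (y - w) by abel, ← this]; congr 1; abel

theorem preservesGridMarginals_of_mem_invariantSubmodule (hp : 1 ≤ p)
    (hΦ : IsWassersteinIsometry Φ)
    (hsupp : ∀ (μ : WassersteinSpace p E) (S : Finset E), μ.toMeasure (S : Set E)ᶜ = 0 →
      ∀ y ∈ (Φ μ).supp, ∃ s ∈ S, y - s ∈ H)
    (hfix : ∀ v : E, FixesFinite Φ (v +ᵥ (H : Set E))) {U k : E}
    (hU : U ∈ invariantSubmodule p H) (hU0 : U ≠ 0) (hk : k ∈ H) (hk0 : k ≠ 0) (x : E) :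
    PreservesGridMarginals Φ ![x, x + k, x + U, x + (U + k)] := by
  classical
  have hp0 : 0 < p := by linarith
  set z : Fin 4 → E := ![x, x + k, x + U, x + (U + k)] with hz
  have hgrid : IsCostGrid p z _ _ := isCostGrid_of_mem_invariantSubmodule hp0.ne' hU hk x
  have hA : 0 < ‖U‖ ^ p := Real.rpow_pos_of_pos (norm_pos_iff.2 hU0) _
  have hB : 0 < ‖k‖ ^ p := Real.rpow_pos_of_pos (norm_pos_iff.2 hk0) _
  have hzinj : Function.Injective z := by
    intro a b hab
    have := hgrid.norm_rpow a b
    rw [hab, sub_self, norm_zero, Real.zero_rpow hp0.ne'] at this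
    revert this
    fin_cases a <;> fin_cases b <;> simp <;> intro h0 <;> linarith
  intro a b c d ha hb hc hd h1 μ hμ
  have hμS : μ.toMeasure ((Finset.univ.image z : Finset E) : Set E)ᶜ = 0 := by
    rw [hμ]; exact discreteMeasure_compl _ _
  have hinv : ∀ l ∈ H, ∀ w, powDiff p l (U + w) = powDiff p l w := fun l hl w => by
    rw [add_comm, hU l hl]
  have hbase : ∀ i, ∃ h ∈ ({0, k} : Set E), (z i - x = h ∨ z i - x = U + h) := by
    intro i
    fin_cases i
    · exact ⟨0, by simp, Or.inl (by simp [hz])⟩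
    · exact ⟨k, by simp, Or.inl (by simp [hz])⟩
    · exact ⟨0, by simp, Or.inr (by simp [hz])⟩
    · exact ⟨k, by simp, Or.inr (by simp [hz])⟩
  have hνS : (Φ μ).toMeasure ((Finset.univ.image z : Finset E) : Set E)ᶜ = 0 := by
    refine measure_compl_eq_zero_of_support_subset fun y hy => ?_
    obtain ⟨s, hs, hs'⟩ := exists_powDiff_eq_of_mem_supp_apply hp hΦ x H
      ((hfix x).mono (insert_image_add_subset_vadd _ _)) hμS hy
    obtain ⟨i, -, rfl⟩ := Finset.mem_image.1 hs
    obtain ⟨s₀, hs₀, hy₀⟩ := hsupp μ _ hμS y hy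
    obtain ⟨j, -, rfl⟩ := Finset.mem_image.1 hs₀
    obtain ⟨hi, hhi, hzi⟩ := hbase i
    obtain ⟨hj, hhj, hzj⟩ := hbase j
    have hmem : ∀ h ∈ ({0, k} : Set E), h ∈ H := by
      rintro _ (rfl | rfl)
      exacts [H.zero_mem, hk]
    have hpi : ∀ l ∈ H, powDiff p l (y - x) = powDiff p l hi := by
      intro l hl
      rw [hs' l hl]
      rcases hzi with h | h
      · rw [h]
      · rw [h, hinv l hl]
    obtain ⟨h, hh, hyh⟩ : ∃ h ∈ H, y - x = h ∨ y - x = U + h := by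
      refine ⟨hj + (y - z j), H.add_mem (hmem _ hhj) hy₀, ?_⟩
      rcases hzj with h | h
      · left; rw [← h]; abel
      · right; rw [← add_assoc, ← h]; abel
    -- The shift `U` is invisible to these functions, so the `H`-components of `y - x` and of the
    -- grid point have equal values, hence coincide.
    have hph : ∀ l ∈ H, powDiff p l (hi + (h - hi)) = powDiff p l hi := by
      intro l hl
      rw [← hpi l hl, add_sub_cancel]
      rcases hyh with h | h
      · rw [h]
      · rw [h, hinv l hl]
    obtain rfl : h = hi :=
      sub_eq_zero.1 (eq_zero_of_powDiff_add_eq hp0 (H.sub_mem hh (hmem _ hhi)) hph)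
    have hfin : ∃ i, z i = y := by
      rcases hhi with rfl | rfl <;> rcases hyh with h' | h'
      · exact ⟨0, by rw [sub_eq_iff_eq_add.1 h']; simp [hz]⟩
      · exact ⟨2, by rw [sub_eq_iff_eq_add.1 h']; simp [hz, add_comm]⟩
      · exact ⟨1, by rw [sub_eq_iff_eq_add.1 h']; simp [hz, add_comm]⟩
      · exact ⟨3, by rw [sub_eq_iff_eq_add.1 h']; simp [hz, add_comm]⟩
    simpa using hfin
  have hpr : ∀ γ : WassersteinSpace p E, IsProbabilityMeasure γ.toMeasure := fun γ => γ.1.2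
  have hν := eq_discreteMeasure hzinj hνS
  set n' : Fin 4 → ℝ := fun a => (Φ μ).toMeasure.real {z a} with hn'
  have hn'0 : ∀ a, 0 ≤ n' a := fun a => measureReal_nonneg
  have hn0 : ∀ i, 0 ≤ (![a, b, c, d] : Fin 4 → ℝ) i := by
    intro i; fin_cases i <;> simpa
  have hsum : n' 0 + n' 1 + n' 2 + n' 3 = 1 := by
    have := (hpr (Φ μ)).measure_univ
    rw [hν, discreteMeasure_apply] at this
    simp only [Set.mem_univ, if_true] at this
    rw [← ENNReal.ofReal_sum_of_nonneg fun i _ => hn'0 i, ENNReal.ofReal_eq_one,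
      Fin.sum_univ_four] at this
    exact this
  -- The `p`-th moment about `x`. Subtracting the column information below leaves the row sum.
  have hcost : n' 1 * ‖k‖ ^ p + n' 2 * ‖U‖ ^ p + n' 3 * (‖U‖ ^ p + ‖k‖ ^ p)
      = b * ‖k‖ ^ p + c * ‖U‖ ^ p + d * (‖U‖ ^ p + ‖k‖ ^ p) := by
    have h := lintegral_iInf_apply_eq hp0 hΦ (fun _ : Unit => z 0) ((hfix x).mono
      (by simp [hz, Set.mem_vadd_set])) (fun _ => 0) μ
    simp only [add_zero, ciInf_const, edist_rpow_eq_ofReal hp0.le] at h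
    rw [hν, hμ, lintegral_discreteMeasure, lintegral_discreteMeasure] at h
    have hnn : ∀ y : E, 0 ≤ ‖y‖ ^ p := fun y => Real.rpow_nonneg (norm_nonneg _) _
    simp only [← ENNReal.ofReal_mul (hn'0 _), ← ENNReal.ofReal_mul (hn0 _)] at h
    rw [← ENNReal.ofReal_sum_of_nonneg fun i _ => mul_nonneg (hn'0 i) (hnn _),
      ← ENNReal.ofReal_sum_of_nonneg fun i _ => mul_nonneg (hn0 i) (hnn _),
      ENNReal.ofReal_eq_ofReal_iff (Finset.sum_nonneg fun i _ => mul_nonneg (hn'0 i) (hnn _))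
        (Finset.sum_nonneg fun i _ => mul_nonneg (hn0 i) (hnn _))] at h
    simp only [hgrid.norm_rpow, Fin.sum_univ_four, Matrix.cons_val] at h
    linarith
  -- `powDiff p k` equals `‖k‖ ^ p` on one column and `-‖k‖ ^ p` on the other, so its law records
  -- the column sums.
  have hcol : n' 1 + n' 3 = b + d := by
    have h := measure_powDiff_eq_apply_eq hp hΦ x (fun _ : Unit => k) ((hfix x).mono
      (Set.Subset.trans (by rintro _ (rfl | ⟨_, rfl⟩); exacts [Or.inl rfl, Or.inr ⟨k, hk, rfl⟩])
        (insert_image_add_subset_vadd x H))) μ (measurableSet_singleton fun _ => -‖k‖ ^ p)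
    have hset : ∀ y : E, y ∈ {x' : E | (fun _ : Unit => powDiff p k (x' - x)) ∈
        ({fun _ => -‖k‖ ^ p} : Set (Unit → ℝ))} ↔ powDiff p k (y - x) = -‖k‖ ^ p := by
      intro y
      exact ⟨fun h => congrFun h (), fun h => funext fun _ => h⟩
    have h0 : powDiff p k 0 = ‖k‖ ^ p := powDiff_zero_right hp0.ne' k
    have hk' : powDiff p k k = -‖k‖ ^ p := by simp [powDiff, Real.zero_rpow hp0.ne']
    have hU' : powDiff p k U = ‖k‖ ^ p := by
      simpa [h0] using hinv k hk 0
    have hne : ‖k‖ ^ p ≠ -‖k‖ ^ p := by linarith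
    rw [hν, hμ, discreteMeasure_apply, discreteMeasure_apply] at h
    simp only [hset, Fin.sum_univ_four, hz, Matrix.cons_val, sub_self, add_sub_cancel_left,
      hinv k hk, hk', h0, hU', hne, if_true, if_false, zero_add, add_zero] at h
    rw [← ENNReal.ofReal_add (hn'0 _) (hn'0 _), ← ENNReal.ofReal_add hb hd,
      ENNReal.ofReal_eq_ofReal_iff (add_nonneg (hn'0 _) (hn'0 _)) (add_nonneg hb hd)] at h
    exact h
  have hrow : n' 2 + n' 3 = c + d := by
    refine mul_right_cancel₀ hA.ne' ?_
    linear_combination hcost - ‖k‖ ^ p * hcol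
  refine ⟨n' 0, n' 1, n' 2, n' 3, hn'0 0, hn'0 1, hn'0 2, hn'0 3, by linarith, hrow,
    by linarith, hcol, ?_⟩
  rw [hν]
  congr 1
  ext i
  fin_cases i <;> rfl

end TwoPoint

/-! ### All two-point measures are fixed -/

section TwoPointFixed

variable {E : Type*} [NormedAddCommGroup E] {p : ℝ} [MeasurableSpace E] [BorelSpace E]

theorem eq_discreteMeasure_pair {x₁ x₂ : E} (hne : x₁ ≠ x₂) {γ : Measure E}
    [IsProbabilityMeasure γ] (hγ : γ ({x₁, x₂} : Set E)ᶜ = 0) :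
    γ = discreteMeasure ![x₁, x₂] ![1 - γ.real {x₂}, γ.real {x₂}] := by
  classical
  have hz : Function.Injective ![x₁, x₂] := by
    intro a b
    fin_cases a <;> fin_cases b <;> simp [hne, hne.symm]
  have hS : (({x₁, x₂} : Finset E) : Set E) = (Finset.univ.image ![x₁, x₂] : Finset E) := by
    ext x; simp [eq_comm, or_comm]
  have h := eq_discreteMeasure hz (γ := γ) (by rw [← hS]; simpa using hγ)
  have hsum : γ.real {x₁} + γ.real {x₂} = 1 := by
    have h1 := measure_univ (μ := γ)
    rw [h, discreteMeasure_apply] at h1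
    simp only [Set.mem_univ, if_true] at h1
    rw [← ENNReal.ofReal_sum_of_nonneg fun i _ => measureReal_nonneg, ENNReal.ofReal_eq_one,
      Fin.sum_univ_two] at h1
    exact h1
  conv_lhs => rw [h]
  congr 1
  ext i
  fin_cases i
  · simp; linarith
  · simp

theorem discreteMeasure_pair_compl (x₁ x₂ : E) (n : Fin 2 → ℝ) :
    discreteMeasure ![x₁, x₂] n ({x₁, x₂} : Set E)ᶜ = 0 := by
  classical
  rw [discreteMeasure_apply]
  simp

variable [SecondCountableTopology E]

/-- The `p`-th moment about `x₁` determines the mass at `x₂`. -/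
theorem apply_eq_of_pair_of_compl (hp : 0 < p) {Φ : WassersteinSpace p E ≃ WassersteinSpace p E}
    (hΦ : IsWassersteinIsometry Φ) {x₁ x₂ : E} (hfix : FixesFinite Φ {x₁}) (hne : x₁ ≠ x₂)
    {μ : WassersteinSpace p E} (hμ : μ.toMeasure ({x₁, x₂} : Set E)ᶜ = 0)
    (hμ' : (Φ μ).toMeasure ({x₁, x₂} : Set E)ᶜ = 0) : Φ μ = μ := by
  have hpr : ∀ γ : WassersteinSpace p E, IsProbabilityMeasure γ.toMeasure := fun γ => γ.1.2
  refine WassersteinSpace.ext_toMeasure ?_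
  have h := lintegral_iInf_apply_eq hp hΦ (fun _ : Unit => x₁) (hfix.mono (by simp)) (fun _ => 0) μ
  simp only [add_zero, ciInf_const] at h
  have key : ∀ γ : Measure E, IsProbabilityMeasure γ → γ ({x₁, x₂} : Set E)ᶜ = 0 →
      ∫⁻ x, edist x x₁ ^ p ∂γ = γ {x₂} * edist x₂ x₁ ^ p := by
    intro γ _ hγ
    conv_lhs => rw [eq_discreteMeasure_pair hne hγ]
    rw [lintegral_discreteMeasure]
    simp [hp]
  rw [key _ (hpr _) hμ, key _ (hpr _) hμ', ENNReal.mul_left_inj (by simp [hp, hne.symm])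
    (ENNReal.rpow_ne_top_of_nonneg hp.le (edist_ne_top _ _))] at h
  rw [eq_discreteMeasure_pair hne hμ, eq_discreteMeasure_pair hne hμ', Measure.real, h,
    ← Measure.real]

theorem transportCost_pair_le (hp : 0 < p) (x₁ x₂ : E) {T T' : ℝ} (h0 : 0 ≤ T') (h : T' ≤ T)
    (h1 : T ≤ 1) : transportCost p (discreteMeasure ![x₁, x₂] ![1 - T, T])
      (discreteMeasure ![x₁, x₂] ![1 - T', T']) ≤ ENNReal.ofReal ((T - T') * ‖x₂ - x₁‖ ^ p) := by
  refine (transportCost_discreteMeasure_le hp.le ![![1 - T, 0], ![T - T', T']] ?_ ?_ ?_).trans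
    (ENNReal.ofReal_le_ofReal ?_)
  · intro a b; fin_cases a <;> fin_cases b <;> simp <;> linarith
  · intro a; fin_cases a <;> simp
  · intro a; fin_cases a <;> simp
  · simp [Fin.sum_univ_two, Real.zero_rpow hp.ne']

variable [NormedSpace ℝ E]
  {Φ : WassersteinSpace p E ≃ WassersteinSpace p E} {H : Submodule ℝ E}

/-- A point of `(Φ μ).supp` outside the pair makes `x₁` and `x₂` opposite corners of a cost grid,
where `μ` is the diagonal measure that cannot move. -/
theorem apply_eq_of_pair_of_lt (hp : 1 ≤ p) (hΦ : IsWassersteinIsometry Φ)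
    (hsupp : ∀ (μ : WassersteinSpace p E) (S : Finset E), μ.toMeasure (S : Set E)ᶜ = 0 →
      ∀ y ∈ (Φ μ).supp, ∃ s ∈ S, y - s ∈ H)
    (hfix : ∀ v : E, FixesFinite Φ (v +ᵥ (H : Set E)))
    {x₁ x₂ : E} (hne : x₁ ≠ x₂) {μ : WassersteinSpace p E}
    (hμ : μ.toMeasure ({x₁, x₂} : Set E)ᶜ = 0)
    (hlt : μ.toMeasure.real {x₂} < 1 / 2) : Φ μ = μ := by
  classical
  have hp0 : 0 < p := by linarith
  have hpr : IsProbabilityMeasure μ.toMeasure := μ.1.2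
  have hsing : ∀ x : E, FixesFinite Φ {x} := fun x =>
    (hfix x).mono (by simp [Set.mem_vadd_set])
  have hμS : μ.toMeasure (({x₁, x₂} : Finset E) : Set E)ᶜ = 0 := by simpa using hμ
  by_cases hdiff : x₂ - x₁ ∈ H
  · refine hfix x₁ μ {x₁, x₂} ?_ hμS
    intro x hx
    rcases Finset.mem_insert.1 (Finset.mem_coe.1 hx) with rfl | hx
    · exact ⟨0, H.zero_mem, by simp⟩
    · rw [Finset.mem_singleton.1 hx]
      exact ⟨x₂ - x₁, hdiff, by simp⟩
  by_cases hsub : (Φ μ).supp ⊆ {x₁, x₂}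
  · exact apply_eq_of_pair_of_compl hp0 hΦ (hsing x₁) hne hμ
      (measure_compl_eq_zero_of_support_subset hsub)
  obtain ⟨k, hk, hk0, hU⟩ : ∃ k ∈ H, k ≠ 0 ∧ x₂ - x₁ - k ∈ invariantSubmodule p H := by
    obtain ⟨y, hy, hy'⟩ := Set.not_subset.1 hsub
    simp only [Set.mem_insert_iff, Set.mem_singleton_iff, not_or] at hy'
    obtain ⟨s, hs, hys⟩ := hsupp μ _ hμS y hy
    rcases Finset.mem_insert.1 hs with rfl | hs
    · exact exists_sub_mem_invariantSubmodule hp hΦ hfix hμ hy hys hy'.1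
    · rw [Finset.mem_singleton.1 hs] at hys
      obtain ⟨k, hk, hk0, hU⟩ := exists_sub_mem_invariantSubmodule (x₂ := x₁) hp hΦ hfix
        (by rwa [Set.pair_comm]) hy hys hy'.2
      refine ⟨-k, H.neg_mem hk, neg_ne_zero.2 hk0, ?_⟩
      have := (invariantSubmodule p H).neg_mem hU
      rwa [show -(x₁ - x₂ - k) = x₂ - x₁ - -k by abel] at this
  set U := x₂ - x₁ - k with hUdef
  have hU0 : U ≠ 0 := fun h => hdiff (by rw [sub_eq_zero.1 (hUdef.symm.trans h)]; exact hk)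
  have hx₂ : x₁ + (U + k) = x₂ := by rw [hUdef]; abel
  rcases eq_or_lt_of_le (measureReal_nonneg (μ := μ.toMeasure) (s := {x₂})) with hT0 | hT0
  · refine hsing x₁ μ {x₁} (by simp) ?_
    have h0 : μ.toMeasure {x₂} = 0 := by
      simpa [measureReal_eq_zero_iff] using hT0.symm
    refine measure_mono_null ?_ (measure_union_null hμ h0)
    intro x hx
    simp only [Finset.coe_singleton, Set.mem_compl_iff, Set.mem_singleton_iff, Set.mem_union,
      Set.mem_insert_iff] at hx ⊢
    tauto
  · refine (isCostGrid_of_mem_invariantSubmodule hp0.ne' hU hk x₁).apply_eq hp0 hΦ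
      (Real.rpow_pos_of_pos (norm_pos_iff.2 hU0) _) (Real.rpow_pos_of_pos (norm_pos_iff.2 hk0) _)
      (preservesGridMarginals_of_mem_invariantSubmodule hp hΦ hsupp hfix hU hU0 hk hk0 x₁)
      hT0 hlt ?_
    rw [hx₂]
    conv_lhs => rw [eq_discreteMeasure_pair hne hμ]
    simp [discreteMeasure, Fin.sum_univ_four, Fin.sum_univ_two]

theorem fixesFinite_pair (hp : 1 ≤ p) (hΦ : IsWassersteinIsometry Φ)
    (hsupp : ∀ (μ : WassersteinSpace p E) (S : Finset E), μ.toMeasure (S : Set E)ᶜ = 0 →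
      ∀ y ∈ (Φ μ).supp, ∃ s ∈ S, y - s ∈ H)
    (hfix : ∀ v : E, FixesFinite Φ (v +ᵥ (H : Set E)))
    (x₁ x₂ : E) : FixesFinite Φ {x₁, x₂} := by
  classical
  intro μ S hS hμS
  have hp0 : 0 < p := by linarith
  have hpr : ∀ γ : WassersteinSpace p E, IsProbabilityMeasure γ.toMeasure := fun γ => γ.1.2
  have hμ : μ.toMeasure ({x₁, x₂} : Set E)ᶜ = 0 :=
    measure_mono_null (Set.compl_subset_compl.2 hS) hμS
  rcases eq_or_ne x₁ x₂ with rfl | hne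
  · exact hfix x₁ μ S (hS.trans (by simp [Set.mem_vadd_set])) hμS
  have hsum : μ.toMeasure.real {x₁} = 1 - μ.toMeasure.real {x₂} := by
    have h := congrArg (fun γ : Measure E => γ.real {x₁}) (eq_discreteMeasure_pair hne hμ)
    simp only [measureReal_def (discreteMeasure _ _), discreteMeasure_apply] at h
    simpa [hne.symm, ENNReal.toReal_ofReal, prob_le_one, measureReal_le_one] using h
  rcases lt_trichotomy (μ.toMeasure.real {x₂}) (1 / 2) with h | h | h
  · exact apply_eq_of_pair_of_lt hp hΦ hsupp hfix hne hμ h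
  -- Equal masses leave no room for changing row sums on the grid; they are a limit of masses `T' <
  -- 1 / 2`.
  · refine WassersteinSpace.ext_toMeasure (measure_eq_of_transportCost_lt hp0 fun η hη => ?_)
    have hT : Tendsto (fun T' : ℝ => ENNReal.ofReal ((1 / 2 - T') * ‖x₂ - x₁‖ ^ p))
        (𝓝[<] (1 / 2)) (𝓝 0) := by
      have : Tendsto (fun T' : ℝ => ENNReal.ofReal ((1 / 2 - T') * ‖x₂ - x₁‖ ^ p))
          (𝓝 (1 / 2)) (𝓝 (ENNReal.ofReal ((1 / 2 - 1 / 2) * ‖x₂ - x₁‖ ^ p))) :=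
        (ENNReal.continuous_ofReal.comp (by fun_prop)).tendsto _
      simpa using this.mono_left nhdsWithin_le_nhds
    obtain ⟨T', ⟨hη', h0⟩, hT'⟩ := (((hT.eventually (gt_mem_nhds (pos_iff_ne_zero.2 hη))).and
      (nhdsWithin_le_nhds (lt_mem_nhds (show (0 : ℝ) < 1 / 2 by norm_num)))).and
      self_mem_nhdsWithin).exists
    have hT'2 : T' < 1 / 2 := hT'
    have hn : ∀ i, 0 ≤ (![1 - T', T'] : Fin 2 → ℝ) i := by
      intro i; fin_cases i <;> simp <;> linarith
    have hprob : IsProbabilityMeasure (discreteMeasure ![x₁, x₂] ![1 - T', T']) :=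
      isProbabilityMeasure_discreteMeasure hn (by simp)
    set β : WassersteinSpace p E := WassersteinSpace.ofFinite hp0
      (discreteMeasure ![x₁, x₂] ![1 - T', T']) ({x₁, x₂} : Finset E)
      (by rw [Finset.coe_pair]; exact discreteMeasure_pair_compl _ _ _)
    have hβm : β.toMeasure = discreteMeasure ![x₁, x₂] ![1 - T', T'] := rfl
    have hcost : transportCost p μ.toMeasure β.toMeasure < η := by
      refine lt_of_le_of_lt ?_ hη'
      rw [hβm]
      conv_lhs => rw [eq_discreteMeasure_pair hne hμ, h]
      exact transportCost_pair_le hp0 x₁ x₂ h0.le hT'2.le (by norm_num)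
    have hβfix : Φ β = β := by
      refine apply_eq_of_pair_of_lt hp hΦ hsupp hfix hne (x₁ := x₁) (x₂ := x₂) ?_ ?_
      · rw [hβm]; exact discreteMeasure_pair_compl _ _ _
      · rw [hβm, measureReal_def, discreteMeasure_apply]
        simpa [hne, ENNReal.toReal_ofReal h0.le] using hT'2
    refine ⟨β.toMeasure, ?_, hcost⟩
    rw [← hβfix, hΦ.transportCost_eq hp0]
    exact hcost
  · exact apply_eq_of_pair_of_lt hp hΦ hsupp hfix hne.symm (by rwa [Set.pair_comm])
      (by rw [hsum]; linarith)

end TwoPointFixed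

/-! ### Two-point measures determine the isometry -/

section TwoPointDetermine

variable {E : Type*} [NormedAddCommGroup E] [NormedSpace ℝ E] {p : ℝ}

theorem frequently_forall_apply_ne [CompleteSpace E] (I : Set ((E →L[ℝ] ℝ) × ℝ))
    (hI : I.Countable) (h0 : ∀ q ∈ I, q.1 ≠ 0) :
    ∃ᶠ e in 𝓝 (0 : E), ∀ q ∈ I, q.1 e ≠ q.2 := by
  refine (frequently_forall_mem I hI (fun q => q.1 ⁻¹' {q.2}ᶜ)
    (fun q _ => isOpen_compl_singleton.preimage q.1.continuous)
    (fun q hq => (dense_compl_singleton q.2).preimage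
      (q.1.isOpenMap_of_ne_zero (h0 q hq)))).mono fun e he q hq => he q hq

theorem sub_mem_powDiffGrads_top {w w' : E} {ξ ξ' : E →L[ℝ] ℝ} (h : IsNormPowGrad p w ξ)
    (h' : IsNormPowGrad p w' ξ') : ξ - ξ' ∈ powDiffGrads p (⊤ : Submodule ℝ E) :=
  ⟨w', w' - w, trivial, ξ, ξ', by rwa [sub_sub_cancel], h', rfl⟩

/-- Finitely many linearly independent gradients of functions `powDiff p l` that have no common
zero and whose differences are again such gradients. -/
theorem exists_linearIndependent_powDiffGrads [FiniteDimensional ℝ E] [MeasurableSpace E]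
    [BorelSpace E] (hp : 1 ≤ p) :
    ∃ b : Set (E →L[ℝ] ℝ), b.Finite ∧ LinearIndependent ℝ ((↑) : b → E →L[ℝ] ℝ) ∧
      b ⊆ powDiffGrads p (⊤ : Submodule ℝ E) ∧
      (∀ f ∈ b, ∀ g ∈ b, f - g ∈ powDiffGrads p (⊤ : Submodule ℝ E)) ∧
      ∀ y : E, (∀ f ∈ b, f y = 0) → y = 0 := by
  obtain ⟨w₀, ξ₀, hξ₀⟩ := (ae_exists_isNormPowGrad (E := E) hp).exists
  -- Subtracting one fixed gradient `ξ₀` keeps differences of basis members of the form `ξ - ξ'`.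
  obtain ⟨b, hb, hspan, hind⟩ := exists_linearIndependent ℝ
    {f : E →L[ℝ] ℝ | ∃ w ξ, IsNormPowGrad p w ξ ∧ f = ξ - ξ₀}
  refine ⟨b, hind.setFinite, hind, fun f hf => ?_, fun f hf g hg => ?_, fun y hy => ?_⟩
  · obtain ⟨w, ξ, hξ, rfl⟩ := hb hf
    exact sub_mem_powDiffGrads_top hξ hξ₀
  · obtain ⟨w, ξ, hξ, rfl⟩ := hb hf
    obtain ⟨w', ξ', hξ', rfl⟩ := hb hg
    rw [sub_sub_sub_cancel_right]
    exact sub_mem_powDiffGrads_top hξ hξ'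
  · have hspan0 : ∀ f ∈ Submodule.span ℝ b, f y = 0 := by
      intro f hf
      induction hf using Submodule.span_induction with
      | mem f hf => exact hy f hf
      | zero => rfl
      | add f g _ _ hf hg => rw [add_apply, hf, hg, add_zero]
      | smul c f _ hf => rw [smul_apply, hf, smul_zero]
    have key : ∀ (w : E) (ξ : E →L[ℝ] ℝ), IsNormPowGrad p w ξ → (ξ - ξ₀) y = 0 :=
      fun w ξ hξ => hspan0 _ (hspan ▸ Submodule.subset_span ⟨w, ξ, hξ, rfl⟩)
    refine eq_zero_of_mem_invariantSubmodule_top (p := p) (by linarith)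
      (mem_invariantSubmodule_of_grads hp ?_)
    rintro _ ⟨w, l, -, ξ, ξ', hξ, hξ', rfl⟩
    rw [← sub_sub_sub_cancel_right ξ ξ' ξ₀, sub_apply, key _ _ hξ,
      key _ _ hξ', sub_zero]

/-- No coincidences occur between the values on `S` of two different functionals from `b`. -/
def IsGenericFor (b : Set (E →L[ℝ] ℝ)) (S : Set E) : Prop :=
  ∀ f ∈ b, ∀ g ∈ insert 0 b, f ≠ g → ∀ x ∈ S, ∀ x' ∈ S, ∀ x'' ∈ S,
    f (x - x'') = g (x' - x'') → x = x''

/-- After the displacement, each forbidden coincidence is an affine equation in `e`. Its linear part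
is nonzero by linear independence and `κ x ≠ κ x''`, so finitely many hyperplanes have to be
avoided. -/
theorem frequently_isGenericFor [CompleteSpace E] {b : Set (E →L[ℝ] ℝ)} (hb : b.Finite)
    (hind : LinearIndependent ℝ ((↑) : b → E →L[ℝ] ℝ)) (S : Finset E) (κ : E → ℕ)
    (hκ : Set.InjOn κ S) :
    ∃ᶠ e in 𝓝 (0 : E), IsGenericFor b ((fun x => x + (κ x : ℝ) • e) '' S) := by
  set F : (E →L[ℝ] ℝ) × (E →L[ℝ] ℝ) × E × E × E → (E →L[ℝ] ℝ) × ℝ := fun q =>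
    (((κ q.2.2.1 : ℝ) - κ q.2.2.2.2) • q.1 - ((κ q.2.2.2.1 : ℝ) - κ q.2.2.2.2) • q.2.1,
      -(q.1 (q.2.2.1 - q.2.2.2.2) - q.2.1 (q.2.2.2.1 - q.2.2.2.2))) with hF
  have hfin : (F '' (b ×ˢ (insert 0 b) ×ˢ (S : Set E) ×ˢ (S : Set E) ×ˢ (S : Set E))).Finite :=
    (hb.prod ((hb.insert 0).prod (S.finite_toSet.prod
      (S.finite_toSet.prod S.finite_toSet)))).image F
  refine (frequently_forall_apply_ne _ (hfin.countable.mono (Set.sep_subset _ fun q => q.1 ≠ 0))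
    fun q hq => hq.2).mono ?_
  rintro e he f hf g hg hfg _ ⟨x, hx, rfl⟩ _ ⟨x', hx', rfl⟩ _ ⟨x'', hx'', rfl⟩ heq
  by_contra hne
  have hxx : (κ x : ℝ) - κ x'' ≠ 0 := by
    rw [sub_ne_zero, Ne, Nat.cast_inj]
    exact fun h => hne (by rw [hκ hx hx'' h])
  refine he (F (f, g, x, x', x'')) ⟨⟨_, ⟨hf, hg, hx, hx', hx''⟩, rfl⟩, fun h0 => hxx ?_⟩ ?_
  · simp only [hF] at h0
    rcases hg with rfl | hg
    · rw [smul_zero, sub_zero, smul_eq_zero] at h0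
      exact h0.resolve_right fun h => hind.ne_zero ⟨f, hf⟩ h
    · have hinj : Function.Injective ![(⟨f, hf⟩ : b), ⟨g, hg⟩] := by
        intro i j
        fin_cases i <;> fin_cases j <;> simp [hfg, hfg.symm]
      have hpair : LinearIndependent ℝ ![f, g] := by
        have := hind.comp _ hinj
        convert this using 1
        ext i
        fin_cases i <;> rfl
      exact (LinearIndependent.pair_iff.1 hpair _ (-((κ x' : ℝ) - κ x''))
        (by rw [neg_smul, ← sub_eq_add_neg]; exact h0)).1
  · simp only [hF, sub_apply, smul_apply, map_sub, map_add,
      map_smul, smul_eq_mul] at heq ⊢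
    linarith

variable [FiniteDimensional ℝ E] [MeasurableSpace E] [BorelSpace E]

theorem apply_eq_of_isGenericFor (hp : 1 ≤ p) {Φ : WassersteinSpace p E ≃ WassersteinSpace p E}
    (hΦ : IsWassersteinIsometry Φ) (hfix : ∀ x₁ x₂ : E, FixesFinite Φ {x₁, x₂})
    {b : Set (E →L[ℝ] ℝ)} (hbG : b ⊆ powDiffGrads p (⊤ : Submodule ℝ E))
    (hbsub : ∀ f ∈ b, ∀ g ∈ b, f - g ∈ powDiffGrads p (⊤ : Submodule ℝ E))
    (hb0 : ∀ y : E, (∀ f ∈ b, f y = 0) → y = 0)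
    (hb1 : ∀ f ∈ b, f ≠ 0) {S : Finset E} (hS : IsGenericFor b (S : Set E))
    {μ : WassersteinSpace p E} (hμ : μ.toMeasure (S : Set E)ᶜ = 0) : Φ μ = μ := by
  have : ProperSpace E := FiniteDimensional.proper_real E
  rcases b.eq_empty_or_nonempty with rfl | ⟨f₀, hf₀⟩
  · have hE : ∀ x y : E, x = y := fun x y => by
      rw [hb0 x (by simp), hb0 y (by simp)]
    have : Subsingleton E := ⟨hE⟩
    refine hfix 0 0 μ S (fun x _ => ?_) hμ
    rw [hE x 0]; simp
  have hgrad : ∀ y ∈ (Φ μ).supp, ∀ η ∈ powDiffGrads p (⊤ : Submodule ℝ E), ∃ s ∈ S, η y = η s :=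
    fun y hy η hη => exists_grad_apply_eq_of_mem_supp_apply hp hΦ
      (fun v l _ => hfix v (v + l)) hμ hy hη
  have hμ' : (Φ μ).toMeasure (S : Set E)ᶜ = 0 := by
    refine measure_compl_eq_zero_of_support_subset fun y hy => ?_
    obtain ⟨s, hs, hsf⟩ := hgrad y hy f₀ (hbG hf₀)
    have hys : y - s = 0 := by
      refine hb0 _ fun f hf => ?_
      rw [map_sub, sub_eq_zero]
      rcases eq_or_ne f₀ f with rfl | hne
      · exact hsf
      obtain ⟨s', hs', hsf'⟩ := hgrad y hy f (hbG hf)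
      -- A priori `f₀`, `f` and `f₀ - f` match `y` with different atoms. The three equations combine
      -- to `f₀ (s - s'') = f (s' - s'')`, and genericity makes the atoms equal.
      obtain ⟨s'', hs'', hsf''⟩ := hgrad y hy (f₀ - f) (hbsub _ hf₀ _ hf)
      rw [sub_apply, sub_apply] at hsf''
      have h1 : s = s'' := hS f₀ hf₀ f (Or.inr hf) hne s hs s' hs' s'' hs'' (by
        rw [map_sub, map_sub]; linarith)
      have h2 : s' = s'' := hS f hf f₀ (Or.inr hf₀) hne.symm s' hs' s hs s'' hs'' (by
        rw [map_sub, map_sub]; linarith)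
      rw [hsf', h1, h2]
    rw [sub_eq_zero.1 hys]
    exact hs
  obtain ⟨w, l, -, ξ, ξ', hξ, hξ', hf⟩ := hbG hf₀
  have hder := hξ.hasFDerivAt_powDiff hξ'
  rw [← hf] at hder
  -- Genericity against `0` makes `f₀` injective on `S`, so after blow-up a single difference
  -- function separates all atoms; two base points suffice.
  have hev : ∀ᶠ ε in 𝓝[>] (0 : ℝ), ∀ q ∈ S.offDiag,
      powDiff p l (w + ε • q.2) ≠ powDiff p l (w + ε • q.1) := by
    rw [Finset.eventually_all]
    intro q hq
    obtain ⟨h1, h2, hne⟩ := Finset.mem_offDiag.1 hq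
    refine eventually_ne_of_apply_ne hder fun h => hne ?_
    exact hS f₀ hf₀ 0 (Or.inl rfl) (hb1 f₀ hf₀) _ h1 _ h1 _ h2 (by rw [map_sub, h]; simp)
  obtain ⟨ε, hε, hε0⟩ := (hev.and self_mem_nhdsWithin).exists
  have hε0 : 0 < ε := hε0
  refine apply_eq_of_separates hp hΦ (v := -(ε⁻¹ • w)) (M := {ε⁻¹ • l})
    (by simpa using hfix _ _) hμ hμ' fun s hs s' hs' hne => ⟨_, rfl, ?_⟩
  have h := hε (s, s') (Finset.mem_offDiag.2 ⟨hs, hs', hne.symm⟩)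
  rw [powDiff_eq_smul hε0.ne', powDiff_eq_smul hε0.ne' l (w + ε • s), smul_add, smul_add,
    inv_smul_smul₀ hε0.ne', inv_smul_smul₀ hε0.ne'] at h
  rw [sub_neg_eq_add, sub_neg_eq_add, add_comm s', add_comm s]
  exact fun h' => h (by rw [h'])

/-- An isometry that fixes all measures with at most two atoms is the identity. -/
theorem apply_eq_of_fixesFinite_pair (hp : 1 ≤ p)
    {Φ : WassersteinSpace p E ≃ WassersteinSpace p E} (hΦ : IsWassersteinIsometry Φ)
    (hfix : ∀ x₁ x₂ : E, FixesFinite Φ {x₁, x₂}) (μ : WassersteinSpace p E) : Φ μ = μ := by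
  have : ProperSpace E := FiniteDimensional.proper_real E
  have hp0 : 0 < p := by linarith
  have hpr : ∀ γ : WassersteinSpace p E, IsProbabilityMeasure γ.toMeasure := fun γ => γ.1.2
  obtain ⟨b, hb, hind, hbG, hbsub, hb0⟩ := exists_linearIndependent_powDiffGrads (E := E) hp
  refine WassersteinSpace.ext_toMeasure (measure_eq_of_transportCost_lt hp0 fun η hη => ?_)
  obtain ⟨S, β, hS, hβ, hcost⟩ := exists_finset_transportCost_lt hp μ (IsGenericFor b)
    (frequently_isGenericFor hb hind) hη
  have hβfix : Φ β = β := apply_eq_of_isGenericFor hp hΦ hfix hbG hbsub hb0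
    (fun f hf => hind.ne_zero ⟨f, hf⟩) hS hβ
  refine ⟨β.toMeasure, ?_, hcost⟩
  rw [← hβfix, hΦ.transportCost_eq hp0]
  exact hcost

end TwoPointDetermine

/-- Let `E` be a finite-dimensional real normed space, that is, `ℝⁿ` with an arbitrary norm. -/
theorem mainTheorem3 {E : Type*} [NormedAddCommGroup E] [NormedSpace ℝ E] [FiniteDimensional ℝ E]
    [MeasurableSpace E] [BorelSpace E] (p : ℝ) (hp : 1 ≤ p)
    (L : Submodule ℝ E) (hL : ProjectsUniquely L) :
    (∃ H : Submodule ℝ E, RestrictsImages p hL H) ∧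
      ∀ H : Submodule ℝ E, RestrictsImages p hL H →
        ∀ Φ : WassersteinSpace p E ≃ WassersteinSpace p E,
          IsWassersteinIsometry Φ →
          FixesMeasuresOnTranslates Φ L →
          ProjectsUniquely H →
          FixesMeasuresOn Φ (H : Set E) →
          ∀ μ : WassersteinSpace p E, Φ μ = μ := by
  refine ⟨exists_restrictsImages hp hL, fun H hH Φ hΦ hfixL _ hfixH => ?_⟩
  have : ProperSpace E := FiniteDimensional.proper_real E
  have hsupp := exists_sub_mem_of_mem_supp_apply (hH.2 Φ hΦ hfixL)
  exact apply_eq_of_fixesFinite_pair hp hΦ (fixesFinite_pair hp hΦ hsupp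
    (fixesFinite_vadd_of_fixesFinite hp hΦ hsupp hfixH.fixesFinite))
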